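/- For $r>0$ and $t>0$ let $$\theta(r,t)=\frac{r}{\sqrt{2\pi^3 t}}\,e^{\frac{\pi^2}{2t}}\int_0^\infty e^{-\frac{\xi^2}{2t}}\,e^{-r\cosh\xi}\,\sinh\xi\,\sin\frac{\pi\xi}{t}\,d\xi ,$$ where the integral converges absolutely. For $0<\rho<1$ the equation $\rho\,\frac{\sinh x_1}{x_1}=1$ has exactly one solution $x_1=x_1(\rho)>0$, and $\rho\cosh x_1-1>0$. For $\rho>1$ the equation $y_1+\rho\sin y_1=\pi$ has exactly one solution $y_1=y_1(\rho)\in(0,\pi)$, and $1+\rho\cos y_1>0$. Define, for $\rho>0$, $$F(\rho)=\begin{cases}\frac12x_1^2-\rho\cosh x_1+\frac{\pi^2}{2}, & 0<\rho<1,\\ \frac{\pi^2}{2}-1, & \rho=1,\\ -\frac12y_1^2+\rho\cos y_1+\pi y_1, & \rho>1,\end{cases}\qquad G(\rho)=\begin{cases}\dfrac{\rho\sinh x_1}{\sqrt{\rho\cosh x_1-1}}, & 0<\rho<1,\\ \sqrt3, & \rho=1,\\ \dfrac{\rho\sin y_1}{\sqrt{1+\rho\cos y_1}}, & \rho>1,\end{cases}$$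 $$\tilde g_2(\rho)=\begin{cases}\dfrac{-12+9\rho\cosh x_1-2\rho^2\cosh^2x_1+5\rho^2}{12(\rho\cosh x_1-1)^3}, & 0<\rho<1,\\[2mm] -\dfrac1{35}, & \rho=1,\\[1mm] \dfrac{12+9\rho\cos y_1+2\rho^2\cos^2y_1-5\rho^2}{12(1+\rho\cos y_1)^3}, & \rho>1,\end{cases}\qquad G_1(\rho)=\frac1{4\pi}G(\rho)\,\tilde g_2(\rho).$$ Then for every fixed $\rho>0$, as $t\to0^+$, $$\theta(\rho/t,t)=e^{-\frac1t\left(F(\rho)-\frac{\pi^2}{2}\right)}\left(\frac{1}{2\pi t}G(\rho)+G_1(\rho)+O(t)\right),$$ where the constant in $O(t)$ may depend on $\rho$. -/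

import Mathlib

open Filter Topology Asymptotics MeasureTheory

namespace HartmanWatson

noncomputable section

/-- The integrand of the Hartman-Watson integral. -/
def integrand (r t ξ : ℝ) : ℝ :=
  Real.exp (-ξ ^ 2 / (2 * t)) * Real.exp (-r * Real.cosh ξ) * Real.sinh ξ *
    Real.sin (Real.pi * ξ / t)

/-- The Hartman-Watson integral `θ(r,t)`. -/
def theta (r t : ℝ) : ℝ :=
  r / Real.sqrt (2 * Real.pi ^ 3 * t) * Real.exp (Real.pi ^ 2 / (2 * t)) *
    ∫ ξ in Set.Ioi (0 : ℝ), integrand r t ξ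

/-- `x` is a positive solution of `ρ sinh x / x = 1`. -/
def IsX1 (ρ x : ℝ) : Prop := 0 < x ∧ ρ * (Real.sinh x / x) = 1

/-- `y` is a solution in `(0, π)` of `y + ρ sin y = π`
(the trivial solution `y = π` is excluded). -/
def IsY1 (ρ y : ℝ) : Prop := 0 < y ∧ y < Real.pi ∧ y + ρ * Real.sin y = Real.pi

/-- The positive solution of `ρ sinh x / x = 1`; it is used for `0 < ρ < 1`. -/
def x1 (ρ : ℝ) : ℝ := Classical.epsilon (IsX1 ρ)

/-- The solution in `(0, π)` of `y + ρ sin y = π`; it is used for `1 < ρ`. -/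
def y1 (ρ : ℝ) : ℝ := Classical.epsilon (IsY1 ρ)

/-- The exponent function `F`. -/
def F (ρ : ℝ) : ℝ :=
  if ρ < 1 then x1 ρ ^ 2 / 2 - ρ * Real.cosh (x1 ρ) + Real.pi ^ 2 / 2
  else if ρ = 1 then Real.pi ^ 2 / 2 - 1
  else -(y1 ρ ^ 2) / 2 + ρ * Real.cos (y1 ρ) + Real.pi * y1 ρ

/-- The coefficient function `G` of the leading term. -/
def G (ρ : ℝ) : ℝ :=
  if ρ < 1 then ρ * Real.sinh (x1 ρ) / Real.sqrt (ρ * Real.cosh (x1 ρ) - 1)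
  else if ρ = 1 then Real.sqrt 3
  else ρ * Real.sin (y1 ρ) / Real.sqrt (1 + ρ * Real.cos (y1 ρ))

/-- The function `g̃₂`. The value at `ρ = 1`, where the closed formulas degenerate to `0/0`,
is the explicit value `-1/35`. -/
def g2 (ρ : ℝ) : ℝ :=
  if ρ < 1 then
    (-12 + 9 * ρ * Real.cosh (x1 ρ) - 2 * ρ ^ 2 * Real.cosh (x1 ρ) ^ 2 + 5 * ρ ^ 2) /
      (12 * (ρ * Real.cosh (x1 ρ) - 1) ^ 3)
  else if ρ = 1 then -1 / 35
  else
    (12 + 9 * ρ * Real.cos (y1 ρ) + 2 * ρ ^ 2 * Real.cos (y1 ρ) ^ 2 - 5 * ρ ^ 2) /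
      (12 * (1 + ρ * Real.cos (y1 ρ)) ^ 3)

/-- The coefficient function `G₁` of the subleading term. -/
def G1 (ρ : ℝ) : ℝ := 1 / (4 * Real.pi) * G ρ * g2 ρ

end

end HartmanWatson

/-!
Write `ρ = exp l` and `h(z) = z² / 2 - ρ cosh z`. After the substitution `z = ξ - iπ` the integral
in `θ(ρ/t, t)` is the imaginary part of `∫ -sinh z exp (-h(z)/t) dz` along the line `Im z = -π`.
The imaginary part of a primitive of the integrand is constant on both coordinate axes, so the line
may be deformed into the curve of steepest descent that starts at the saddle point: `x₁` for
`ρ < 1`, `-i(π - y₁)` for `ρ > 1`, and the origin for `ρ = 1` (`im_primitive_curve`,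
`im_primitive_line`, `tendsto_integral_curve`).

On `z = x - iy` the condition `Im h = 0` reads `ρ (sinh x / x) (sin y / y) = 1`. Both factors are
values of one entire function `sinhcSqrt`, at `p = x²` and at `-q = -y²`, and `log ∘ sinhcSqrt` is a
smooth bijection of `(-π², ∞)` onto `ℝ` with inverse `lam`. Hence `p = lam (w - l)`,
`q = -lam (-w)` is a parametrisation of the curve which is smooth in `w`, covers `ρ < 1`, `ρ = 1`
and `ρ > 1` alike, and carries the reflection symmetry `w ↦ l - w`. The curve starts at
`w = max 0 l`.

Along the curve `Im (-sinh z dz) = d(xy) / ρ`, so after an integration by parts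
`θ(ρ/t, t)` is a multiple of the Laplace integral `∫ exp (-H/t) xy dH`, where `H = h - h(saddle)`
is increasing. It remains to expand `xy` in powers of `H`. The square `pq = (xy)²` has an expansion
`m₁ H + m₂ H² + O(H³)` (`isBigO_defect`): for `ρ ≠ 1` this is a first order computation at a simple
saddle point (`vanishesTo_defect`), and at `ρ = 1` a fifth order computation in `(p + q) / 2`, in
which only odd powers occur (`vanishesTo_defect_zero`). Everything is expressed through
`kap`, twice the logarithmic derivative of `sinhcSqrt`, and its Riccati equation. Taking square
roots gives `xy = c₁ H^(1/2) + c₃ H^(3/2) + O(H^(5/2))` on the whole curve (`exists_sqrt_expansion`), and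
integrating term by term gives the claim (`exists_laplace_bound`).
-/

namespace HartmanWatson

open scoped Nat ContDiff

noncomputable section

/-! ### Entire power series with coefficients bounded by `1 / n!` -/

/-- The real power series with coefficients `c`. -/
def powerSum (c : ℕ → ℝ) (p : ℝ) : ℝ := ∑' n, c n * p ^ n

/-- The coefficients are dominated by those of the exponential series; this class is stable under
shifting and under termwise differentiation. -/
def ExpBounded (c : ℕ → ℝ) : Prop := ∀ n, |c n| ≤ 1 / (n ! : ℝ)

lemma ExpBounded.summable {c : ℕ → ℝ} (hc : ExpBounded c) (p : ℝ) :
    Summable fun n => c n * p ^ n := by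
  refine Summable.of_norm_bounded (Real.summable_pow_div_factorial |p|) fun n => ?_
  rw [norm_mul, norm_pow, Real.norm_eq_abs, Real.norm_eq_abs, div_eq_inv_mul, ← one_div]
  exact mul_le_mul_of_nonneg_right (hc n) (by positivity)

lemma ExpBounded.shift {c : ℕ → ℝ} (hc : ExpBounded c) : ExpBounded fun n => c (n + 1) := by
  intro n
  refine (hc (n + 1)).trans (one_div_le_one_div_of_le (by positivity) ?_)
  exact_mod_cast Nat.factorial_le n.le_succ

lemma ExpBounded.derivCoeff {c : ℕ → ℝ} (hc : ExpBounded c) :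
    ExpBounded fun n => (n + 1) * c (n + 1) := by
  intro n
  have h := hc (n + 1)
  rw [abs_mul, abs_of_pos (by positivity : (0 : ℝ) < n + 1)]
  calc ((n : ℝ) + 1) * |c (n + 1)| ≤ (n + 1) * (1 / ((n + 1)! : ℝ)) := by gcongr
    _ = 1 / (n ! : ℝ) := by
      rw [Nat.factorial_succ]; push_cast; field_simp

lemma powerSum_eq_add {c : ℕ → ℝ} (hc : ExpBounded c) (p : ℝ) :
    powerSum c p = c 0 + p * powerSum (fun n => c (n + 1)) p := by
  rw [powerSum, (hc.summable p).tsum_eq_zero_add, powerSum, ← tsum_mul_left]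
  simp only [pow_zero, mul_one]
  congr 1
  exact tsum_congr fun n => by ring

lemma hasDerivAt_powerSum {c : ℕ → ℝ} (hc : ExpBounded c) (p : ℝ) :
    HasDerivAt (powerSum c) (powerSum (fun n => (n + 1) * c (n + 1)) p) p := by
  set R := |p| + 1 with hR
  have hR0 : 0 < R := by positivity
  have hu : Summable fun n : ℕ => (n : ℝ) * |c n| * R ^ (n - 1) := by
    refine (summable_nat_add_iff 1).1 ?_
    have := (hc.derivCoeff.summable R).abs
    refine this.congr fun n => ?_
    simp [abs_mul, abs_of_pos hR0, abs_of_pos (by positivity : (0 : ℝ) < n + 1)]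
  have key := hasDerivAt_tsum_of_isPreconnected (𝕜 := ℝ) (t := Metric.ball 0 R)
    (g := fun n p => c n * p ^ n) (g' := fun n p => c n * (n * p ^ (n - 1))) (y₀ := p) (y := p)
    hu Metric.isOpen_ball (convex_ball _ _).isPreconnected
    (fun n y _ => (hasDerivAt_pow n y).const_mul (c n)) (fun n y hy => by
      have hy' : |y| ≤ R := by
        simpa using (Metric.mem_ball.1 hy).le
      rw [norm_mul, norm_mul, norm_pow, Real.norm_eq_abs, Real.norm_eq_abs, Real.norm_eq_abs,
        Nat.abs_cast, ← mul_assoc, mul_comm |c n|]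
      gcongr)
    (by simp [hR]) (hc.summable p) (by simp [hR])
  refine key.congr_deriv ?_
  have hs : Summable fun n : ℕ => c n * (n * p ^ (n - 1)) := by
    refine (summable_nat_add_iff 1).1 ((hc.derivCoeff.summable p).congr fun n => ?_)
    push_cast; ring
  rw [hs.tsum_eq_zero_add, powerSum]
  simp only [Nat.cast_zero, zero_mul, mul_zero, zero_add]
  refine tsum_congr fun n => ?_
  push_cast; ring

lemma contDiff_powerSum_nat (n : ℕ) : ∀ {c : ℕ → ℝ}, ExpBounded c → ContDiff ℝ n (powerSum c) := by
  induction n with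
  | zero =>
    intro c hc
    exact contDiff_zero.2 (continuous_iff_continuousAt.2 fun p =>
      (hasDerivAt_powerSum hc p).continuousAt)
  | succ n ih =>
    intro c hc
    rw [Nat.cast_add, Nat.cast_one]
    refine contDiff_succ_iff_deriv.2 ⟨fun p => (hasDerivAt_powerSum hc p).differentiableAt,
      by simp, ?_⟩
    rw [show deriv (powerSum c) = _ from funext fun p => (hasDerivAt_powerSum hc p).deriv]
    exact ih hc.derivCoeff

lemma contDiff_powerSum {c : ℕ → ℝ} (hc : ExpBounded c) : ContDiff ℝ ∞ (powerSum c) :=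
  contDiff_infty.2 fun n => contDiff_powerSum_nat n hc

/-! ### Hyperbolic and trigonometric functions of a square root -/

/-- Coefficients of `cosh √p`. -/
def coshCoeff (n : ℕ) : ℝ := 1 / ((2 * n)! : ℝ)

/-- Coefficients of `sinh √p / √p`. -/
def sinhCoeff (n : ℕ) : ℝ := 1 / ((2 * n + 1)! : ℝ)

/-- Coefficients of `(cosh √p - sinh √p / √p) / p`. -/
def diffCoeff (n : ℕ) : ℝ := (2 * n + 2) / ((2 * n + 3)! : ℝ)

/-- The entire function equal to `cosh √p` for `p ≥ 0` and to `cos √(-p)` for `p ≤ 0`. -/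
def coshSqrt (p : ℝ) : ℝ := powerSum coshCoeff p

/-- The entire function equal to `sinh √p / √p` for `p > 0` and to `sin √(-p) / √(-p)` for
`p < 0`. -/
def sinhcSqrt (p : ℝ) : ℝ := powerSum sinhCoeff p

/-- Twice the derivative of `sinhcSqrt`. -/
def sinhcSqrtDeriv (p : ℝ) : ℝ := powerSum diffCoeff p

lemma expBounded_coshCoeff : ExpBounded coshCoeff := by
  intro n
  rw [coshCoeff, abs_of_pos (by positivity)]
  refine one_div_le_one_div_of_le (by positivity) ?_
  exact_mod_cast Nat.factorial_le (by omega)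

lemma expBounded_sinhCoeff : ExpBounded sinhCoeff := by
  intro n
  rw [sinhCoeff, abs_of_pos (by positivity)]
  refine one_div_le_one_div_of_le (by positivity) ?_
  exact_mod_cast Nat.factorial_le (by omega)

lemma expBounded_diffCoeff : ExpBounded diffCoeff := by
  intro n
  rw [diffCoeff, abs_of_pos (by positivity), div_le_div_iff₀ (by positivity) (by positivity),
    one_mul, show 2 * n + 3 = (2 * n + 2) + 1 by ring, Nat.factorial_succ]
  have h : (n ! : ℝ) ≤ ((2 * n + 2)! : ℝ) := by exact_mod_cast Nat.factorial_le (by omega)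
  push_cast
  nlinarith [(by positivity : (0 : ℝ) ≤ n), (by positivity : (0 : ℝ) < (n ! : ℝ)),
    mul_le_mul_of_nonneg_left h (by positivity : (0 : ℝ) ≤ 2 * n + 2)]

lemma hasDerivAt_coshSqrt (p : ℝ) : HasDerivAt coshSqrt (sinhcSqrt p / 2) p := by
  refine (hasDerivAt_powerSum expBounded_coshCoeff p).congr_deriv ?_
  rw [sinhcSqrt, powerSum, powerSum, ← tsum_div_const]
  refine tsum_congr fun n => ?_
  rw [coshCoeff, sinhCoeff, show 2 * (n + 1) = (2 * n + 1) + 1 by ring, Nat.factorial_succ]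
  push_cast
  field_simp
  ring

lemma hasDerivAt_sinhcSqrt (p : ℝ) : HasDerivAt sinhcSqrt (sinhcSqrtDeriv p / 2) p := by
  refine (hasDerivAt_powerSum expBounded_sinhCoeff p).congr_deriv ?_
  rw [sinhcSqrtDeriv, powerSum, powerSum, ← tsum_div_const]
  refine tsum_congr fun n => ?_
  rw [diffCoeff, sinhCoeff, show 2 * (n + 1) + 1 = 2 * n + 3 by ring]
  ring

lemma contDiff_sinhcSqrt : ContDiff ℝ ∞ sinhcSqrt := contDiff_powerSum expBounded_sinhCoeff

lemma contDiff_sinhcSqrtDeriv : ContDiff ℝ ∞ sinhcSqrtDeriv :=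
  contDiff_powerSum expBounded_diffCoeff

lemma coshSqrt_eq (p : ℝ) : coshSqrt p = sinhcSqrt p + p * sinhcSqrtDeriv p := by
  have h := powerSum_eq_add expBounded_coshCoeff p
  have h' := powerSum_eq_add expBounded_sinhCoeff p
  rw [coshSqrt, sinhcSqrt, h, h', sinhcSqrtDeriv]
  have e : powerSum (fun n => coshCoeff (n + 1)) p
      = powerSum (fun n => sinhCoeff (n + 1)) p + powerSum diffCoeff p := by
    rw [powerSum, powerSum, powerSum, ← (expBounded_sinhCoeff.shift.summable p).tsum_add
      (expBounded_diffCoeff.summable p)]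
    refine tsum_congr fun n => ?_
    rw [coshCoeff, sinhCoeff, diffCoeff, show 2 * (n + 1) + 1 = (2 * n + 2) + 1 by ring,
      show 2 * n + 3 = (2 * n + 2) + 1 by ring, show 2 * (n + 1) = 2 * n + 2 by ring,
      Nat.factorial_succ (2 * n + 2)]
    push_cast
    field_simp
    ring
  rw [e]
  simp [coshCoeff, sinhCoeff]
  ring

lemma coshSqrt_sq (x : ℝ) : coshSqrt (x ^ 2) = Real.cosh x := by
  rw [← (Real.hasSum_cosh x).tsum_eq, coshSqrt, powerSum]
  refine tsum_congr fun n => ?_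
  rw [coshCoeff, ← pow_mul]; ring

lemma coshSqrt_neg_sq (y : ℝ) : coshSqrt (-y ^ 2) = Real.cos y := by
  rw [← (Real.hasSum_cos y).tsum_eq, coshSqrt, powerSum]
  refine tsum_congr fun n => ?_
  rw [coshCoeff, neg_pow, ← pow_mul]; ring

lemma mul_sinhcSqrt_sq (x : ℝ) : x * sinhcSqrt (x ^ 2) = Real.sinh x := by
  rw [← (Real.hasSum_sinh x).tsum_eq, sinhcSqrt, powerSum, ← tsum_mul_left]
  refine tsum_congr fun n => ?_
  rw [sinhCoeff, ← pow_mul]; ring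

lemma mul_sinhcSqrt_neg_sq (y : ℝ) : y * sinhcSqrt (-y ^ 2) = Real.sin y := by
  rw [← (Real.hasSum_sin y).tsum_eq, sinhcSqrt, powerSum, ← tsum_mul_left]
  refine tsum_congr fun n => ?_
  rw [sinhCoeff, neg_pow, ← pow_mul]; ring

lemma coshSqrt_sq_sub (p : ℝ) : coshSqrt p ^ 2 - p * sinhcSqrt p ^ 2 = 1 := by
  rcases le_total 0 p with hp | hp
  · obtain ⟨x, rfl⟩ : ∃ x, p = x ^ 2 := ⟨√p, (Real.sq_sqrt hp).symm⟩
    rw [coshSqrt_sq, ← mul_pow, mul_sinhcSqrt_sq, Real.cosh_sq_sub_sinh_sq]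
  · obtain ⟨y, rfl⟩ : ∃ y, p = -y ^ 2 := ⟨√(-p), by rw [Real.sq_sqrt (by linarith)]; ring⟩
    rw [coshSqrt_neg_sq, neg_mul, ← mul_pow, mul_sinhcSqrt_neg_sq, sub_neg_eq_add,
      Real.cos_sq_add_sin_sq]

lemma sinhcSqrt_zero : sinhcSqrt 0 = 1 := by
  rw [sinhcSqrt, powerSum_eq_add expBounded_sinhCoeff]; simp [sinhCoeff]

lemma sinhcSqrtDeriv_zero : sinhcSqrtDeriv 0 = 1 / 3 := by
  rw [sinhcSqrtDeriv, powerSum_eq_add expBounded_diffCoeff]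
  simp [diffCoeff, Nat.factorial]; norm_num

lemma sinhcSqrt_pos {p : ℝ} (hp : -Real.pi ^ 2 < p) : 0 < sinhcSqrt p := by
  rcases le_or_gt 0 p with h | h
  · refine (expBounded_sinhCoeff.summable p).tsum_pos (fun n => ?_) 0 ?_
    · rw [sinhCoeff]; positivity
    · simp [sinhCoeff]
  · have hy : 0 < √(-p) := Real.sqrt_pos.2 (by linarith)
    have hp' : -√(-p) ^ 2 = p := by rw [Real.sq_sqrt (by linarith)]; ring
    have hπ : √(-p) < Real.pi := (Real.sqrt_lt' Real.pi_pos).2 (by linarith)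
    have e := mul_sinhcSqrt_neg_sq √(-p)
    rw [hp'] at e
    exact pos_of_mul_pos_right (e ▸ Real.sin_pos_of_pos_of_lt_pi hy hπ) hy.le

lemma sinhcSqrtDeriv_pos {p : ℝ} (hp : -Real.pi ^ 2 < p) : 0 < sinhcSqrtDeriv p := by
  rcases le_or_gt 0 p with h | h
  · refine (expBounded_diffCoeff.summable p).tsum_pos (fun n => ?_) 0 ?_
    · rw [diffCoeff]; positivity
    · rw [diffCoeff]; positivity
  · have hy : 0 < √(-p) := Real.sqrt_pos.2 (by linarith)
    have hp' : -√(-p) ^ 2 = p := by rw [Real.sq_sqrt (by linarith)]; ring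
    have hπ : √(-p) < Real.pi := (Real.sqrt_lt' Real.pi_pos).2 (by linarith)
    set y := √(-p)
    have e := mul_sinhcSqrt_neg_sq y
    have e' := coshSqrt_neg_sq y
    rw [hp'] at e e'
    rw [coshSqrt_eq] at e'
    -- the claim amounts to `y cos y < sin y` on `(0, π)`
    have hlt : y * Real.cos y < Real.sin y := by
      rcases lt_or_ge y (Real.pi / 2) with h2 | h2
      · have hc := Real.cos_pos_of_mem_Ioo ⟨by linarith, h2⟩
        have := Real.lt_tan hy h2
        rwa [Real.tan_eq_sin_div_cos, lt_div_iff₀ hc] at this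
      · have hc := Real.cos_nonpos_of_pi_div_two_le_of_le h2 (by linarith [Real.pi_pos])
        have hs := Real.sin_pos_of_pos_of_lt_pi hy hπ
        nlinarith
    have h3 : 0 < y * -p * sinhcSqrtDeriv p := by rw [← e, ← e'] at hlt; linarith
    exact pos_of_mul_pos_right h3 (mul_pos hy (by linarith)).le

lemma sinhcSqrt_neg_pi_sq : sinhcSqrt (-Real.pi ^ 2) = 0 := by
  have := mul_sinhcSqrt_neg_sq Real.pi
  rw [Real.sin_pi] at this
  exact (mul_eq_zero.1 this).resolve_left Real.pi_ne_zero

lemma strictMonoOn_sinhcSqrt : StrictMonoOn sinhcSqrt (Set.Ici (-Real.pi ^ 2)) := by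
  refine strictMonoOn_of_deriv_pos (convex_Ici _) contDiff_sinhcSqrt.continuous.continuousOn ?_
  intro p hp
  rw [interior_Ici] at hp
  rw [(hasDerivAt_sinhcSqrt p).deriv]
  exact half_pos (sinhcSqrtDeriv_pos hp)

lemma le_sinhcSqrt {p : ℝ} (hp : 0 ≤ p) : p / 6 ≤ sinhcSqrt p := by
  rw [sinhcSqrt, powerSum_eq_add expBounded_sinhCoeff, powerSum_eq_add expBounded_sinhCoeff.shift]
  have h : 0 ≤ powerSum (fun n => sinhCoeff (n + 1 + 1)) p :=
    tsum_nonneg fun n => by simp only [sinhCoeff]; positivity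
  have h1 : sinhCoeff (0 + 1) = 1 / 6 := by norm_num [sinhCoeff, Nat.factorial]
  have h0 : sinhCoeff 0 = 1 := by simp [sinhCoeff]
  rw [h1, h0]
  nlinarith [mul_nonneg hp (mul_nonneg hp h)]

/-! ### The logarithmic derivative of `sinhcSqrt` -/

/-- Twice the logarithmic derivative of `sinhcSqrt`: the function equal to `(x coth x - 1) / x ^ 2`
at `p = x ^ 2` and to `(1 - y cot y) / y ^ 2` at `p = - y ^ 2`. -/
def kap (p : ℝ) : ℝ := sinhcSqrtDeriv p / sinhcSqrt p

lemma kap_pos {p : ℝ} (hp : -Real.pi ^ 2 < p) : 0 < kap p :=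
  div_pos (sinhcSqrtDeriv_pos hp) (sinhcSqrt_pos hp)

lemma kap_zero : kap 0 = 1 / 3 := by rw [kap, sinhcSqrt_zero, sinhcSqrtDeriv_zero]; norm_num

lemma coshSqrt_eq_mul {p : ℝ} (hp : -Real.pi ^ 2 < p) :
    coshSqrt p = sinhcSqrt p * (1 + p * kap p) := by
  rw [coshSqrt_eq, kap]
  field_simp [(sinhcSqrt_pos hp).ne']

lemma contDiffAt_kap {p : ℝ} (hp : -Real.pi ^ 2 < p) : ContDiffAt ℝ ∞ kap p :=
  contDiff_sinhcSqrtDeriv.contDiffAt.div contDiff_sinhcSqrt.contDiffAt (sinhcSqrt_pos hp).ne'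

lemma differentiableAt_kap {p : ℝ} (hp : -Real.pi ^ 2 < p) : DifferentiableAt ℝ kap p :=
  (contDiffAt_kap hp).differentiableAt (by simp)

/-- The Riccati equation for `kap`. -/
lemma mul_deriv_kap {p : ℝ} (hp : -Real.pi ^ 2 < p) :
    p * deriv kap p = (1 - 3 * kap p - p * kap p ^ 2) / 2 := by
  have hD : DifferentiableAt ℝ sinhcSqrtDeriv p :=
    contDiff_sinhcSqrtDeriv.contDiffAt.differentiableAt (by simp)
  have hS := (sinhcSqrt_pos hp).ne'
  have h1 : HasDerivAt kap _ p := hD.hasDerivAt.div (hasDerivAt_sinhcSqrt p) hS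
  have h2 : HasDerivAt coshSqrt _ p :=
    ((hasDerivAt_sinhcSqrt p).add ((hasDerivAt_id p).mul hD.hasDerivAt)).congr_of_eventuallyEq
      (Eventually.of_forall fun q => by simp [coshSqrt_eq])
  have h3 := h2.unique (hasDerivAt_coshSqrt p)
  simp only [id] at h3
  have h4 : p * deriv sinhcSqrtDeriv p = (sinhcSqrt p - 3 * sinhcSqrtDeriv p) / 2 := by linarith
  rw [h1.deriv, kap]
  field_simp
  linear_combination 2 * sinhcSqrt p * h4

/-- The third order Taylor expansion of `kap` at the origin, with an explicit form of the
remainder. -/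
lemma exists_kap_expansion : ∃ R : ℝ → ℝ, ContinuousAt R 0 ∧ ∀ p, -Real.pi ^ 2 < p →
    kap p = 1 / 3 - p / 45 + 2 * p ^ 2 / 945 - p ^ 3 / 4725 + p ^ 4 * R p := by
  have hs := expBounded_sinhCoeff
  have hd := expBounded_diffCoeff
  set S := powerSum fun n => sinhCoeff (n + 1 + 1 + 1 + 1) with hS
  set D := powerSum fun n => diffCoeff (n + 1 + 1 + 1 + 1) with hD
  have eS : ∀ p, sinhcSqrt p = 1 + p / 6 + p ^ 2 / 120 + p ^ 3 / 5040 + p ^ 4 * S p := by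
    intro p
    rw [sinhcSqrt, powerSum_eq_add hs, powerSum_eq_add hs.shift, powerSum_eq_add hs.shift.shift,
      powerSum_eq_add hs.shift.shift.shift, ← hS]
    norm_num [sinhCoeff, Nat.factorial]
    ring
  have eD : ∀ p, sinhcSqrtDeriv p = 1 / 3 + p / 30 + p ^ 2 / 840 + p ^ 3 / 45360 + p ^ 4 * D p := by
    intro p
    rw [sinhcSqrtDeriv, powerSum_eq_add hd, powerSum_eq_add hd.shift,
      powerSum_eq_add hd.shift.shift,
      powerSum_eq_add hd.shift.shift.shift, ← hD]
    norm_num [diffCoeff, Nat.factorial]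
    ring
  have cS : Continuous S := (contDiff_powerSum hs.shift.shift.shift.shift).continuous
  have cD : Continuous D := (contDiff_powerSum hd.shift.shift.shift.shift).continuous
  refine ⟨fun p => (D p - (1 / 3 - p / 45 + 2 * p ^ 2 / 945 - p ^ 3 / 4725) * S p
    + (1 / 45 * (1 / 5040) - 2 / 945 * (1 / 120) + 1 / 4725 * (1 / 6))
    + (1 / 4725 * (1 / 120) - 2 / 945 * (1 / 5040)) * p + 1 / 4725 * (1 / 5040) * p ^ 2)
    / sinhcSqrt p, ?_, fun p hp => ?_⟩
  · have := contDiff_sinhcSqrt.continuous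
    exact ContinuousAt.div (by fun_prop) (by fun_prop) (by simp [sinhcSqrt_zero])
  · rw [kap, mul_div_assoc', div_eq_iff (sinhcSqrt_pos hp).ne', add_mul,
      div_mul_cancel₀ _ (sinhcSqrt_pos hp).ne', eD, eS]
    ring

/-! ### The inverse of `log ∘ sinhcSqrt` -/

lemma exists_sinhcSqrt_eq (w : ℝ) : ∃ p, -Real.pi ^ 2 < p ∧ sinhcSqrt p = Real.exp w := by
  have hle : -Real.pi ^ 2 ≤ 6 * Real.exp w := by
    have := Real.exp_pos w
    nlinarith [sq_nonneg Real.pi]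
  obtain ⟨p, hp, e⟩ := intermediate_value_Icc hle contDiff_sinhcSqrt.continuous.continuousOn
    (show Real.exp w ∈ Set.Icc _ _ from ⟨by rw [sinhcSqrt_neg_pi_sq]; positivity, by
      have := le_sinhcSqrt (p := 6 * Real.exp w) (by positivity)
      linarith⟩)
  refine ⟨p, lt_of_le_of_ne hp.1 ?_, e⟩
  rintro rfl
  rw [sinhcSqrt_neg_pi_sq] at e
  exact (Real.exp_pos w).ne e

/-- The inverse of the increasing bijection `log ∘ sinhcSqrt : (-π², ∞) → ℝ`. -/
def lam (w : ℝ) : ℝ := Classical.choose (exists_sinhcSqrt_eq w)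

lemma neg_pi_sq_lt_lam (w : ℝ) : -Real.pi ^ 2 < lam w :=
  (Classical.choose_spec (exists_sinhcSqrt_eq w)).1

lemma sinhcSqrt_lam (w : ℝ) : sinhcSqrt (lam w) = Real.exp w :=
  (Classical.choose_spec (exists_sinhcSqrt_eq w)).2

lemma lam_eq_of_sinhcSqrt_eq {p w : ℝ} (hp : -Real.pi ^ 2 < p) (h : sinhcSqrt p = Real.exp w) :
    lam w = p :=
  strictMonoOn_sinhcSqrt.injOn (neg_pi_sq_lt_lam w).le hp.le ((sinhcSqrt_lam w).trans h.symm)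

lemma lam_log_sinhcSqrt {p : ℝ} (hp : -Real.pi ^ 2 < p) : lam (Real.log (sinhcSqrt p)) = p :=
  lam_eq_of_sinhcSqrt_eq hp (Real.exp_log (sinhcSqrt_pos hp)).symm

lemma lam_zero : lam 0 = 0 :=
  lam_eq_of_sinhcSqrt_eq (by simp [Real.pi_pos]) (by rw [sinhcSqrt_zero, Real.exp_zero])

lemma strictMono_lam : StrictMono lam := by
  intro v w h
  rw [← strictMonoOn_sinhcSqrt.lt_iff_lt (neg_pi_sq_lt_lam v).le (neg_pi_sq_lt_lam w).le,
    sinhcSqrt_lam, sinhcSqrt_lam]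
  exact Real.exp_lt_exp.2 h

lemma continuous_lam : Continuous lam := by
  refine continuous_iff_continuousAt.2 fun w =>
    (strictMono_lam.strictMonoOn Set.univ).continuousAt_of_image_mem_nhds univ_mem ?_
  filter_upwards [Ioi_mem_nhds (neg_pi_sq_lt_lam w)] with p hp
  exact ⟨_, Set.mem_univ _, lam_log_sinhcSqrt hp⟩

lemma tendsto_lam_atTop : Tendsto lam atTop atTop := by
  refine strictMono_lam.monotone.tendsto_atTop_atTop fun b =>
    ⟨Real.log (sinhcSqrt (max b 0)), ?_⟩
  rw [lam_log_sinhcSqrt (lt_of_lt_of_le (by simp [Real.pi_pos]) (le_max_right b 0))]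
  exact le_max_left b 0

lemma hasDerivAt_lam (w : ℝ) : HasDerivAt lam (2 / kap (lam w)) w := by
  have hp := neg_pi_sq_lt_lam w
  have h : HasDerivAt (fun p => Real.log (sinhcSqrt p)) (kap (lam w) / 2) (lam w) := by
    refine ((hasDerivAt_sinhcSqrt (lam w)).log (sinhcSqrt_pos hp).ne').congr_deriv ?_
    rw [kap]; ring
  have hk := kap_pos hp
  refine (HasDerivAt.of_local_left_inverse continuous_lam.continuousAt h (by positivity)
    (Eventually.of_forall fun v => ?_)).congr_deriv (inv_div _ _)
  simp only [sinhcSqrt_lam, Real.log_exp]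

lemma contDiff_lam : ContDiff ℝ ∞ lam := by
  refine contDiff_infty.2 fun n => ?_
  induction n with
  | zero => exact contDiff_zero.2 continuous_lam
  | succ n ih =>
    rw [Nat.cast_add, Nat.cast_one]
    refine contDiff_succ_iff_deriv.2 ⟨fun w => (hasDerivAt_lam w).differentiableAt, by simp, ?_⟩
    rw [show deriv lam = _ from funext fun w => (hasDerivAt_lam w).deriv]
    refine contDiff_iff_contDiffAt.2 fun w => contDiffAt_const.div
      (ContDiffAt.comp w ((contDiffAt_kap (neg_pi_sq_lt_lam w)).of_le ?_) ih.contDiffAt)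
      (kap_pos (neg_pi_sq_lt_lam w)).ne'
    exact_mod_cast le_top

/-! ### The steepest descent curve -/

/-- The square of the real part of the steepest descent curve for `ρ = exp l`. -/
def pp (l w : ℝ) : ℝ := lam (w - l)

/-- The square of the imaginary part of the steepest descent curve. -/
def qq (w : ℝ) : ℝ := -lam (-w)

/-- The value of `kap` at `pp`. -/
def al (l w : ℝ) : ℝ := kap (lam (w - l))

/-- The value of `kap` at `-qq`. -/
def be (w : ℝ) : ℝ := kap (lam (-w))

/-- The value of the phase at the saddle point. -/
def saddleValue (l : ℝ) : ℝ := lam (-l) / 2 - (1 + lam (-l) * kap (lam (-l)))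

/-- The phase along the steepest descent curve, normalised to vanish at the saddle point. -/
def height (l w : ℝ) : ℝ :=
  (pp l w - qq w) / 2 - (1 + pp l w * al l w) * (1 - qq w * be w) - saddleValue l

lemma al_pos (l w : ℝ) : 0 < al l w := kap_pos (neg_pi_sq_lt_lam _)

lemma be_pos (w : ℝ) : 0 < be w := kap_pos (neg_pi_sq_lt_lam _)

lemma pp_reflect (l w : ℝ) : pp l (l - w) = -qq w := by
  rw [pp, qq, neg_neg]; congr 1; ring

lemma qq_reflect (l w : ℝ) : qq (l - w) = -pp l w := by
  rw [pp, qq]; congr 2; ring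

lemma al_reflect (l w : ℝ) : al l (l - w) = be w := by
  rw [al, be]; congr 2; ring

lemma be_reflect (l w : ℝ) : be (l - w) = al l w := by
  rw [al, be]; congr 2; ring

lemma height_reflect (l w : ℝ) : height l (l - w) = height l w := by
  rw [height, pp_reflect, qq_reflect, al_reflect, be_reflect, height]; ring

lemma qq_zero : qq 0 = 0 := by rw [qq, neg_zero, lam_zero, neg_zero]

lemma be_zero : be 0 = 1 / 3 := by rw [be, neg_zero, lam_zero, kap_zero]

lemma pp_zero (l : ℝ) : pp l 0 = lam (-l) := by rw [pp, zero_sub]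

lemma al_zero (l : ℝ) : al l 0 = kap (lam (-l)) := by rw [al, zero_sub]

lemma height_zero (l : ℝ) : height l 0 = 0 := by
  rw [height, qq_zero, be_zero, pp_zero, al_zero, saddleValue]; ring

lemma height_self (l : ℝ) : height l l = 0 := by
  simpa [height_zero] using height_reflect l 0

lemma pp_self (l : ℝ) : pp l l = 0 := by rw [pp, sub_self, lam_zero]

lemma hasDerivAt_pp (l w : ℝ) : HasDerivAt (pp l) (2 / al l w) w := by
  exact (hasDerivAt_lam (w - l)).comp_sub_const w l

lemma hasDerivAt_qq (w : ℝ) : HasDerivAt qq (2 / be w) w := by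
  refine ((hasDerivAt_lam (-w)).comp w (hasDerivAt_neg w)).neg.congr_deriv ?_
  rw [be]; ring

lemma contDiff_pp (l : ℝ) : ContDiff ℝ ∞ (pp l) :=
  contDiff_lam.comp (contDiff_id.sub contDiff_const)

lemma contDiff_qq : ContDiff ℝ ∞ qq := (contDiff_lam.comp contDiff_neg).neg

lemma contDiff_al (l : ℝ) : ContDiff ℝ ∞ (al l) :=
  contDiff_iff_contDiffAt.2 fun w => (contDiffAt_kap (neg_pi_sq_lt_lam (w - l))).comp w
    (contDiff_pp l).contDiffAt

lemma contDiff_be : ContDiff ℝ ∞ be :=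
  contDiff_iff_contDiffAt.2 fun w => (contDiffAt_kap (neg_pi_sq_lt_lam (-w))).comp w
    (contDiff_lam.comp contDiff_neg).contDiffAt

lemma contDiff_height (l : ℝ) : ContDiff ℝ ∞ (height l) :=
  (((((contDiff_pp l).sub contDiff_qq).div_const 2).sub
    ((contDiff_const.add ((contDiff_pp l).mul (contDiff_al l))).mul
      (contDiff_const.sub (contDiff_qq.mul contDiff_be))))).sub contDiff_const

lemma hasDerivAt_mul_kap {p : ℝ} (hp : -Real.pi ^ 2 < p) :
    HasDerivAt (fun p => p * kap p) ((1 - kap p - p * kap p ^ 2) / 2) p := by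
  refine ((hasDerivAt_id p).mul (differentiableAt_kap hp).hasDerivAt).congr_deriv ?_
  simp only [id, mul_deriv_kap hp]
  ring

lemma hasDerivAt_pp_mul_al (l w : ℝ) : HasDerivAt (fun w => pp l w * al l w)
    ((1 - al l w - pp l w * al l w ^ 2) / al l w) w := by
  refine ((hasDerivAt_mul_kap (neg_pi_sq_lt_lam (w - l))).comp w (hasDerivAt_pp l w)).congr_deriv ?_
  have := (al_pos l w).ne'
  change (1 - al l w - pp l w * al l w ^ 2) / 2 * (2 / al l w) = _
  field_simp

lemma hasDerivAt_qq_mul_be (w : ℝ) : HasDerivAt (fun w => qq w * be w)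
    ((1 - be w + qq w * be w ^ 2) / be w) w := by
  have h := ((hasDerivAt_mul_kap (neg_pi_sq_lt_lam (-w))).comp w
    ((hasDerivAt_lam (-w)).comp w (hasDerivAt_neg w))).neg
  refine (h.congr_of_eventuallyEq (Eventually.of_forall fun v => ?_)).congr_deriv ?_
  · simp [qq, be]
  · have := (be_pos w).ne'
    rw [← be, show lam (-w) = -qq w by simp [qq]]
    field_simp
    ring

/-- The phase derivative is a sum of nonnegative terms where `pp` and `qq` are nonnegative. -/
lemma hasDerivAt_height (l w : ℝ) : HasDerivAt (height l)
    (qq w * be w / al l w + pp l w * al l w / be w) w := by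
  have h := ((((hasDerivAt_pp l w).sub (hasDerivAt_qq w)).div_const 2).sub
    (((hasDerivAt_pp_mul_al l w).const_add 1).mul
      ((hasDerivAt_qq_mul_be w).const_sub 1))).sub_const (saddleValue l)
  refine h.congr_deriv ?_
  have := (be_pos w).ne'
  have := (al_pos l w).ne'
  field_simp
  ring

lemma hasDerivAt_pp_mul_qq (l w : ℝ) : HasDerivAt (fun w => pp l w * qq w)
    (2 * qq w / al l w + 2 * pp l w / be w) w := by
  refine ((hasDerivAt_pp l w).mul (hasDerivAt_qq w)).congr_deriv ?_
  ring

lemma pp_nonneg {l w : ℝ} (h : l ≤ w) : 0 ≤ pp l w := by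
  rw [pp, ← lam_zero]; exact strictMono_lam.monotone (by linarith)

lemma pp_pos {l w : ℝ} (h : l < w) : 0 < pp l w := by
  rw [pp, ← lam_zero]; exact strictMono_lam (by linarith)

lemma qq_nonneg {w : ℝ} (h : 0 ≤ w) : 0 ≤ qq w := by
  rw [qq, neg_nonneg, ← lam_zero]; exact strictMono_lam.monotone (by linarith)

lemma qq_pos {w : ℝ} (h : 0 < w) : 0 < qq w := by
  rw [qq, neg_pos, ← lam_zero]; exact strictMono_lam (by linarith)

lemma qq_lt (w : ℝ) : qq w < Real.pi ^ 2 := by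
  have := neg_pi_sq_lt_lam (-w)
  rw [qq]; linarith

lemma height_max (l : ℝ) : height l (max 0 l) = 0 := by
  rcases max_choice 0 l with h | h <;> rw [h]
  · exact height_zero l
  · exact height_self l

lemma pp_mul_qq_max (l : ℝ) : pp l (max 0 l) * qq (max 0 l) = 0 := by
  rcases max_choice 0 l with h | h <;> rw [h]
  · rw [qq_zero, mul_zero]
  · rw [pp_self, zero_mul]

lemma strictMonoOn_height (l : ℝ) : StrictMonoOn (height l) (Set.Ici (max 0 l)) := by
  refine strictMonoOn_of_deriv_pos (convex_Ici _) (contDiff_height l).continuous.continuousOn ?_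
  intro w hw
  rw [interior_Ici, Set.mem_Ioi, max_lt_iff] at hw
  rw [(hasDerivAt_height l w).deriv]
  have := qq_pos hw.1
  have := pp_pos hw.2
  have := al_pos l w
  have := be_pos w
  positivity

lemma height_pos {l w : ℝ} (h : max 0 l < w) : 0 < height l w := by
  rw [← height_max l]; exact strictMonoOn_height l Set.self_mem_Ici h.le h

lemma height_nonneg {l w : ℝ} (h : max 0 l ≤ w) : 0 ≤ height l w := by
  rw [← height_max l]; exact (strictMonoOn_height l).monotoneOn Set.self_mem_Ici h h

/-- Along the curve the phase grows at least like half the square of the real part. -/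
lemma exists_pp_le (l : ℝ) : ∃ C, 0 ≤ C ∧ ∀ w, max 0 l ≤ w → pp l w ≤ 2 * height l w + C := by
  have hπ := Real.pi_pos
  have hq : -Real.pi ^ 2 < -(Real.pi / 2) ^ 2 := by nlinarith
  set v := -Real.log (sinhcSqrt (-(Real.pi / 2) ^ 2)) with hv
  refine ⟨Real.pi ^ 2 + 2 * |saddleValue l| + |pp l v|, by positivity, fun w hw => ?_⟩
  rcases le_total w v with h | h
  · have h1 : pp l w ≤ pp l v := strictMono_lam.monotone (by linarith)
    have := height_nonneg hw
    nlinarith [le_abs_self (pp l v), abs_nonneg (saddleValue l), sq_nonneg Real.pi]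
  · have h1 : Real.pi / 2 ≤ √(qq w) := by
      refine Real.le_sqrt_of_sq_le ?_
      have h2 : lam (-w) ≤ lam (-v) := strictMono_lam.monotone (by linarith)
      rw [hv, neg_neg, lam_log_sinhcSqrt hq] at h2
      rw [qq]; linarith
    -- for `y ≥ π / 2` the term `ρ cosh x cos y` of the phase is nonpositive
    have hqn : 0 ≤ qq w := qq_nonneg ((le_max_left _ _).trans hw)
    have h3 : √(qq w) ≤ Real.pi := Real.sqrt_le_iff.2 ⟨hπ.le, (qq_lt w).le⟩
    have h4 := Real.cos_nonpos_of_pi_div_two_le_of_le h1 (by linarith)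
    have e : -√(qq w) ^ 2 = lam (-w) := by rw [Real.sq_sqrt hqn, qq, neg_neg]
    rw [← coshSqrt_neg_sq, e, coshSqrt_eq_mul (neg_pi_sq_lt_lam _), ← be] at h4
    have h5 : 1 - qq w * be w ≤ 0 := by
      rw [qq, neg_mul, sub_neg_eq_add]
      exact nonpos_of_mul_nonpos_right h4 (sinhcSqrt_pos (neg_pi_sq_lt_lam _))
    have h6 : 0 ≤ 1 + pp l w * al l w := by
      have := pp_nonneg ((le_max_right 0 l).trans hw)
      have := al_pos l w
      positivity
    have h7 := mul_nonpos_of_nonneg_of_nonpos h6 h5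
    have h8 : height l w = (pp l w - qq w) / 2 - (1 + pp l w * al l w) * (1 - qq w * be w)
      - saddleValue l := rfl
    linarith [qq_lt w, le_abs_self (saddleValue l), abs_nonneg (pp l v)]

lemma tendsto_pp (l : ℝ) : Tendsto (pp l) atTop atTop :=
  tendsto_lam_atTop.comp (tendsto_atTop_add_const_right _ _ tendsto_id)

lemma tendsto_height (l : ℝ) : Tendsto (height l) atTop atTop := by
  obtain ⟨C, -, hC⟩ := exists_pp_le l
  refine tendsto_atTop_mono' (f₁ := fun w => (pp l w + -C) / 2) _ ?_
    ((tendsto_atTop_add_const_right _ _ (tendsto_pp l)).atTop_div_const two_pos)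
  filter_upwards [eventually_ge_atTop (max 0 l)] with w hw
  linarith [hC w hw]

/-! ### Orders of vanishing at the origin -/

/-- `f` vanishes at the origin at least to order `k`. -/
def VanishesTo (k : ℕ) (f : ℝ → ℝ) : Prop := f =O[𝓝 0] fun w => w ^ k

namespace VanishesTo

variable {f g : ℝ → ℝ} {j k : ℕ}

lemma add (hf : VanishesTo k f) (hg : VanishesTo k g) : VanishesTo k fun w => f w + g w :=
  IsBigO.add hf hg

lemma sub (hf : VanishesTo k f) (hg : VanishesTo k g) : VanishesTo k fun w => f w - g w :=
  IsBigO.sub hf hg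

lemma const_mul (hf : VanishesTo k f) (c : ℝ) : VanishesTo k fun w => c * f w :=
  IsBigO.const_mul_left hf c

lemma mul (hf : VanishesTo j f) (hg : VanishesTo k g) : VanishesTo (j + k) fun w => f w * g w := by
  simpa only [VanishesTo, pow_add] using IsBigO.mul hf hg

lemma pow (hf : VanishesTo k f) (n : ℕ) : VanishesTo (k * n) fun w => f w ^ n := by
  simpa only [VanishesTo, pow_mul] using IsBigO.pow hf n

lemma mono (hf : VanishesTo k f) (h : j ≤ k) : VanishesTo j f := by
  refine IsBigO.trans hf (IsBigO.of_bound 1 ?_)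
  filter_upwards [Metric.ball_mem_nhds (0 : ℝ) one_pos] with w hw
  have hw' : |w| ≤ 1 := by simpa using (Metric.mem_ball.1 hw).le
  rw [norm_pow, norm_pow, one_mul, Real.norm_eq_abs]
  exact pow_le_pow_of_le_one (abs_nonneg w) hw' h

lemma congr (hf : VanishesTo k f) (h : ∀ᶠ w in 𝓝 0, f w = g w) : VanishesTo k g :=
  IsBigO.congr' hf h EventuallyEq.rfl

lemma of_continuousAt (hf : ContinuousAt f 0) : VanishesTo 0 f := by
  simpa [VanishesTo] using hf.tendsto.isBigO_one ℝ

lemma of_differentiableAt (hf : DifferentiableAt ℝ f 0) (h0 : f 0 = 0) : VanishesTo 1 f := by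
  simpa [VanishesTo, h0] using hf.isBigO_sub

/-- Integration raises the order of vanishing by one. -/
lemma of_hasDerivAt {f' : ℝ → ℝ} (hf : ∀ w, HasDerivAt f (f' w) w) (h0 : f 0 = 0)
    (hf' : VanishesTo k f') : VanishesTo (k + 1) f := by
  obtain ⟨C, hC⟩ := IsBigO.bound hf'
  obtain ⟨ε, hε, hball⟩ := Metric.eventually_nhds_iff_ball.1 hC
  refine IsBigO.of_bound C ?_
  filter_upwards [Metric.ball_mem_nhds (0 : ℝ) hε] with w hw
  have hw' : |w| < ε := by simpa using hw
  have hC0 : 0 ≤ C * |w| ^ k := by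
    simpa using (norm_nonneg _).trans (hball w hw)
  have h := (convex_closedBall (0 : ℝ) |w|).norm_image_sub_le_of_norm_hasDerivWithin_le
    (f := f) (f' := f') (C := C * |w| ^ k) (x := 0) (y := w)
    (fun x _ => (hf x).hasDerivWithinAt) (fun x hx => by
      have hx' : |x| ≤ |w| := by simpa using hx
      have h1 := hball x (by simpa using hx'.trans_lt hw')
      rw [norm_pow, Real.norm_eq_abs x] at h1
      refine h1.trans ?_
      rcases le_or_gt 0 C with hC' | hC'
      · gcongr
      · have h2 : |x| ^ k = 0 := by
          have h3 := (norm_nonneg _).trans h1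
          exact le_antisymm (nonpos_of_mul_nonneg_right h3 hC') (by positivity)
        rw [h2, mul_zero]; exact hC0)
    (by simp) (by simp)
  rw [h0, sub_zero, sub_zero, Real.norm_eq_abs w] at h
  rw [norm_pow, Real.norm_eq_abs w, pow_succ, ← mul_assoc]
  exact h

lemma of_contDiff (hf : ContDiff ℝ ∞ f) (h0 : f 0 = 0) (h1 : deriv f 0 = 0) : VanishesTo 2 f := by
  have h := contDiff_infty_iff_deriv.1 hf
  exact of_hasDerivAt (fun w => (h.1 w).hasDerivAt) h0
    (of_differentiableAt ((h.2.differentiable (by simp)) 0) h1)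

end VanishesTo

/-! ### The product of the squared coordinates as a function of the phase -/

/-- The function `g2` in terms of `l = log ρ`. For `lam (-l) ≠ 0` both closed formulas of `g2`
become this one rational function of `lam (-l)` and `kap (lam (-l))`. -/
def coeff (l : ℝ) : ℝ :=
  if lam (-l) = 0 then -1 / 35 else
    (3 * (lam (-l) * kap (lam (-l))) ^ 2 + 15 * (lam (-l) * kap (lam (-l))) - 5 * lam (-l)) /
      (12 * (lam (-l) * kap (lam (-l))) ^ 3)

/-- The difference of `pp * qq` and its second order expansion in powers of the phase. The linear
coefficient is `2 * G ^ 2`, and the quadratic one is `2 / 3 * g2` times the linear one. -/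
def defect (l w : ℝ) : ℝ :=
  pp l w * qq w - 2 / kap (lam (-l)) * height l w
    - 4 * coeff l / (3 * kap (lam (-l))) * height l w ^ 2

/-- The derivative of `defect`, up to the factor `1 / (al * be)`. -/
def defectNum (l w : ℝ) : ℝ :=
  2 * (qq w * be w + pp l w * al l w)
    - (2 / kap (lam (-l)) + 8 * coeff l / (3 * kap (lam (-l))) * height l w)
      * (qq w * be w ^ 2 + pp l w * al l w ^ 2)

lemma hasDerivAt_defect (l w : ℝ) :
    HasDerivAt (defect l) (1 / (al l w * be w) * defectNum l w) w := by
  have h := ((hasDerivAt_pp_mul_qq l w).sub ((hasDerivAt_height l w).const_mul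
    (2 / kap (lam (-l))))).sub (((hasDerivAt_height l w).pow 2).const_mul
      (4 * coeff l / (3 * kap (lam (-l)))))
  refine h.congr_deriv ?_
  have := (al_pos l w).ne'
  have := (be_pos w).ne'
  have hk := (kap_pos (neg_pi_sq_lt_lam (-l))).ne'
  rw [defectNum]
  generalize kap (lam (-l)) = k at *
  generalize coeff l = c at *
  field_simp
  push_cast
  ring

lemma defect_zero (l : ℝ) : defect l 0 = 0 := by simp [defect, qq_zero, height_zero]

lemma contDiff_defectNum (l : ℝ) : ContDiff ℝ ∞ (defectNum l) := by
  have := contDiff_pp l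
  have := contDiff_qq
  have := contDiff_al l
  have := contDiff_be
  have := contDiff_height l
  unfold defectNum
  fun_prop

lemma vanishesTo_inv_al_mul_be (l : ℝ) : VanishesTo 0 fun w => 1 / (al l w * be w) := by
  have := (contDiff_al l).continuous.continuousAt (x := 0)
  have := contDiff_be.continuous.continuousAt (x := 0)
  exact VanishesTo.of_continuousAt (ContinuousAt.div (by fun_prop) (by fun_prop)
    (mul_pos (al_pos l 0) (be_pos 0)).ne')

lemma exists_hasDerivAt_al (l w : ℝ) : ∃ a', HasDerivAt (al l) a' w ∧
    pp l w * a' = (1 - 3 * al l w - pp l w * al l w ^ 2) / al l w := by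
  have hw := neg_pi_sq_lt_lam (w - l)
  refine ⟨_, (differentiableAt_kap hw).hasDerivAt.comp w (hasDerivAt_pp l w), ?_⟩
  have h := mul_deriv_kap hw
  rw [← mul_assoc, pp, h, ← al]
  have := (al_pos l w).ne'
  field_simp

/-- Away from `ρ = 1` the saddle point is simple, and it is enough that `defectNum` and its
derivative vanish there. -/
lemma vanishesTo_defect {l : ℝ} (hl : lam (-l) ≠ 0) : VanishesTo 3 (defect l) := by
  have hk := (kap_pos (neg_pi_sq_lt_lam (-l))).ne'
  refine VanishesTo.of_hasDerivAt (hasDerivAt_defect l) (defect_zero l) ?_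
  have h2 : VanishesTo 2 (defectNum l) := by
    refine VanishesTo.of_contDiff (contDiff_defectNum l) ?_ ?_
    · rw [defectNum, qq_zero, height_zero, pp_zero, al_zero]
      field_simp; ring
    · obtain ⟨a', ha, ha'⟩ := exists_hasDerivAt_al l 0
      have hb : HasDerivAt be _ 0 := (contDiff_be.differentiable (by simp) 0).hasDerivAt
      have hq := hasDerivAt_qq 0
      have hp := hasDerivAt_pp l 0
      have h := ((((hq.mul hb).add (hp.mul ha)).const_mul 2).sub
        ((((hasDerivAt_height l 0).const_mul (8 * coeff l / (3 * kap (lam (-l))))).const_add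
          (2 / kap (lam (-l)))).mul ((hq.mul (hb.pow 2)).add (hp.mul (ha.pow 2)))))
      have h' : deriv (defectNum l) 0 = _ := h.deriv
      rw [h']
      simp only [qq_zero, height_zero, pp_zero, al_zero, be_zero, coeff, if_neg hl, Pi.mul_apply,
        Pi.add_apply, Pi.pow_apply] at ha' ⊢
      rw [eq_div_iff hk] at ha'
      generalize kap (lam (-l)) = k at *
      generalize lam (-l) = p at *
      have ha2 : a' = (1 - 3 * k - p * k ^ 2) / (p * k) := by
        field_simp; linear_combination ha'
      subst ha2
      field_simp
      push_cast
      ring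
  simpa using (vanishesTo_inv_al_mul_be l).mul h2

/-- At `ρ = 1` the saddle point is degenerate, and `pp` and `qq` vanish together. The expansions
below are in powers of their mean value. -/
lemma vanishesTo_defect_zero : VanishesTo 6 (defect 0) ∧ VanishesTo 4
    (fun w => height 0 w - ((pp 0 w + qq w) / 2) ^ 2 / 6) := by
  obtain ⟨R, hR, hkap⟩ := exists_kap_expansion
  set s : ℝ → ℝ := fun w => (pp 0 w + qq w) / 2 with hs
  set d : ℝ → ℝ := fun w => (pp 0 w - qq w) / 2 with hd
  have hp0 : pp 0 0 = 0 := pp_self 0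
  have hq0 := qq_zero
  have cp : ContinuousAt (pp 0) 0 := (contDiff_pp 0).continuous.continuousAt
  have cq : ContinuousAt qq 0 := contDiff_qq.continuous.continuousAt
  have oα : VanishesTo 0 (al 0) := .of_continuousAt (contDiff_al 0).continuous.continuousAt
  have oβ : VanishesTo 0 be := .of_continuousAt contDiff_be.continuous.continuousAt
  have oinv := vanishesTo_inv_al_mul_be 0
  have op : VanishesTo 1 (pp 0) :=
    .of_differentiableAt ((contDiff_pp 0).differentiable (by simp) 0) hp0
  have oq : VanishesTo 1 qq :=
    .of_differentiableAt (contDiff_qq.differentiable (by simp) 0) hq0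
  have os : VanishesTo 1 s := ((op.add oq).const_mul (1 / 2)).congr
    (Eventually.of_forall fun w => by simp only [hs]; ring)
  -- the fourth order remainders in the expansions of `al` and `be`
  set ra : ℝ → ℝ := fun w => pp 0 w ^ 4 * R (pp 0 w) with hra
  set rb : ℝ → ℝ := fun w => qq w ^ 4 * R (-qq w) with hrb
  have ora : VanishesTo 4 ra := by
    refine (op.pow 4).mul (k := 0) (.of_continuousAt (ContinuousAt.comp (g := R) ?_ cp))
    rwa [hp0]
  have orb : VanishesTo 4 rb := by
    refine (oq.pow 4).mul (k := 0) (.of_continuousAt (ContinuousAt.comp (g := R) ?_ cq.neg))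
    rwa [hq0, neg_zero]
  have ea : ∀ w, al 0 w = 1 / 3 - pp 0 w / 45 + 2 * pp 0 w ^ 2 / 945 - pp 0 w ^ 3 / 4725
      + ra w := fun w => hkap _ (neg_pi_sq_lt_lam _)
  have eb : ∀ w, be w = 1 / 3 + qq w / 45 + 2 * qq w ^ 2 / 945 + qq w ^ 3 / 4725
      + rb w := by
    intro w
    rw [be, hkap _ (neg_pi_sq_lt_lam _), hrb]
    simp only [qq, neg_neg]; ring
  have eα := fun w => (al_pos 0 w).ne'
  have eβ := fun w => (be_pos w).ne'
  have hs' : ∀ w, HasDerivAt s (1 / (al 0 w * be w) * (al 0 w + be w)) w := fun w =>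
    (((hasDerivAt_pp 0 w).add (hasDerivAt_qq w)).div_const 2).congr_deriv
      (by field_simp [eα w, eβ w]; ring)
  have hd' : ∀ w, HasDerivAt d (1 / (al 0 w * be w) * (be w - al 0 w)) w := fun w =>
    (((hasDerivAt_pp 0 w).sub (hasDerivAt_qq w)).div_const 2).congr_deriv
      (by field_simp [eα w, eβ w])
  have s0 : s 0 = 0 := by simp [hs, hp0, hq0]
  have d0 : d 0 = 0 := by simp [hd, hp0, hq0]
  have od : VanishesTo 2 d := by
    refine .of_hasDerivAt hd' d0 (oinv.mul (k := 1) ?_)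
    have := (((oq.add op).const_mul (1 / 45)).add (((oq.pow 2).sub (op.pow 2)).const_mul
      (2 / 945) |>.mono (by norm_num : 1 ≤ 1 * 2))).add ((((oq.pow 3).add (op.pow 3)).const_mul
      (1 / 4725)).mono (by norm_num : 1 ≤ 1 * 3)) |>.add ((orb.sub ora).mono (by norm_num : 1 ≤ 4))
    refine this.congr (Eventually.of_forall fun w => ?_)
    rw [ea, eb]; ring
  have op' : ∀ w, pp 0 w = s w + d w := fun w => by simp only [hs, hd]; ring
  have oq' : ∀ w, qq w = s w - d w := fun w => by simp only [hs, hd]; ring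
  -- `al + be = 2 / 3 + O(w ^ 2)`
  have osum : VanishesTo 2 fun w => al 0 w + be w - 2 / 3 := by
    have := ((od.const_mul (-2 / 45)).add (((oq.pow 2).add (op.pow 2)).const_mul
      (2 / 945))).add ((((oq.pow 3).sub (op.pow 3)).const_mul
      (1 / 4725)).mono (by norm_num : 2 ≤ 1 * 3)) |>.add ((orb.add ora).mono (by norm_num : 2 ≤ 4))
    refine this.congr (Eventually.of_forall fun w => ?_)
    rw [ea, eb]; simp only [hd]; ring
  have odiff : VanishesTo 3 fun w => be w - al 0 w - 2 * s w / 45 := by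
    have := ((os.mul od).const_mul (-8 / 945)).add (((oq.pow 3).add (op.pow 3)).const_mul
      (1 / 4725)) |>.add ((orb.sub ora).mono (by norm_num : 3 ≤ 4))
    refine this.congr (Eventually.of_forall fun w => ?_)
    rw [ea, eb]; simp only [hd, hs]; ring
  have od4 : VanishesTo 4 fun w => d w - s w ^ 2 / 30 := by
    refine .of_hasDerivAt (fun w => (hd' w).sub (((hs' w).pow 2).div_const 30)) (by simp [s0, d0])
      ((oinv.mul (odiff.sub ((os.mul osum).const_mul (1 / 15)))).congr
        (Eventually.of_forall fun w => ?_))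
    push_cast; ring
  have ob : VanishesTo 1 (fun w => qq w * be w ^ 2 + pp 0 w * al 0 w ^ 2) :=
    (oq.mul (oβ.pow 2)).add (op.mul (oα.pow 2))
  -- expansions of the two terms of the derivative of the defect
  have o1 : VanishesTo 5 fun w => qq w * be w + pp 0 w * al 0 w
      - (2 * s w / 3 - 4 * (s w * d w) / 45 + 4 * s w ^ 3 / 945) := by
    have := ((oq.mul orb).add (op.mul ora)).add (((os.mul (od.pow 2)).const_mul (12 / 945)).add
      ((((os.pow 3).mul od).const_mul (-8 / 4725)))) |>.add
      (((os.mul (od.pow 3)).const_mul (-8 / 4725)).mono (by norm_num : 5 ≤ 1 + 2 * 3))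
    refine this.congr (Eventually.of_forall fun w => ?_)
    rw [ea, eb, op', oq']; ring
  have o2 : VanishesTo 5 fun w => qq w * be w ^ 2 + pp 0 w * al 0 w ^ 2
      - (2 * s w / 9 - 8 * (s w * d w) / 135 + 2 * s w ^ 3 / 525) := by
    have oA : VanishesTo 0 fun w => al 0 w + (1 / 3 - pp 0 w / 45 + 2 * pp 0 w ^ 2 / 945
        - pp 0 w ^ 3 / 4725) :=
      .of_continuousAt (by have := (contDiff_al 0).continuous.continuousAt (x := 0); fun_prop)
    have oB : VanishesTo 0 fun w => be w + (1 / 3 + qq w / 45 + 2 * qq w ^ 2 / 945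
        + qq w ^ 3 / 4725) :=
      .of_continuousAt (by have := contDiff_be.continuous.continuousAt (x := 0); fun_prop)
    have oA' : VanishesTo 0 fun w => (2 / 945) ^ 2 + 2 / (45 * 4725)
        - 4 / (945 * 4725) * pp 0 w + pp 0 w ^ 2 / 4725 ^ 2 :=
      .of_continuousAt (by fun_prop)
    have oB' : VanishesTo 0 fun w => (2 / 945) ^ 2 + 2 / (45 * 4725)
        + 4 / (945 * 4725) * qq w + qq w ^ 2 / 4725 ^ 2 :=
      .of_continuousAt (by fun_prop)
    have := ((oq.mul (orb.mul oB)).add (op.mul (ora.mul oA))).add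
      (((oq.pow 5).mul oB').add ((op.pow 5).mul oA')) |>.add
      (((os.mul (od.pow 2)).const_mul (6 / 525)).add
      ((((os.pow 3).mul od).const_mul (-16 / 8505)))) |>.add
      (((os.mul (od.pow 3)).const_mul (-16 / 8505)).mono (by norm_num : 5 ≤ 1 + 2 * 3))
    refine this.congr (Eventually.of_forall fun w => ?_)
    rw [ea, eb, op', oq']; ring
  have oH : VanishesTo 4 fun w => height 0 w - s w ^ 2 / 6 := by
    refine .of_hasDerivAt (fun w => (hasDerivAt_height 0 w).sub (((hs' w).pow 2).div_const 6))
      (by simp [s0, height_zero]) ((oinv.mul (k := 3) (f := fun w => 1 / (al 0 w * be w))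
        (g := fun w => (qq w * be w ^ 2 + pp 0 w * al 0 w ^ 2)
          - s w * (al 0 w + be w) / 3) ?_).congr (Eventually.of_forall fun w => ?_))
    · have := ((o2.mono (by norm_num : 3 ≤ 5)).add (((os.mul od).const_mul (-8 / 135)).add
        ((os.pow 3).const_mul (2 / 525)))).sub ((os.mul osum).const_mul (1 / 3))
      refine this.congr (Eventually.of_forall fun w => ?_)
      ring
    · have := eα w
      have := eβ w
      field_simp
      push_cast; ring
  refine ⟨.of_hasDerivAt (hasDerivAt_defect 0) (defect_zero 0) (oinv.mul (k := 5) ?_), oH⟩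
  have := ((((os.mul od4).const_mul (8 / 45)).add ((o1.const_mul 2).sub (o2.const_mul 6))).add
    (((oH.mul ob).const_mul (8 / 35)))).add ((((os.pow 3).mul od).const_mul (-32 / 14175)).add
      ((os.pow 5).const_mul (8 / 55125))) |>.add
      ((((os.pow 2).mul o2).const_mul (4 / 105)).mono (by norm_num : 5 ≤ 1 * 2 + 5))
  refine this.congr (Eventually.of_forall fun w => ?_)
  have e0 : lam (-0) = 0 := by rw [neg_zero, lam_zero]
  rw [defectNum, coeff, if_pos e0, e0, kap_zero]
  ring

lemma lam_neg_eq_zero_iff {l : ℝ} : lam (-l) = 0 ↔ l = 0 := by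
  rw [← lam_zero, strictMono_lam.injective.eq_iff, lam_zero, neg_eq_zero]

lemma defect_reflect (l w : ℝ) : defect l (l - w) = defect l w := by
  rw [defect, height_reflect, pp_reflect, qq_reflect, defect]; ring

lemma isBigO_defect (l : ℝ) :
    defect l =O[𝓝 0] fun w => height l w ^ 3 := by
  rcases eq_or_ne l 0 with rfl | hl
  · obtain ⟨h6, h4⟩ := vanishesTo_defect_zero
    have hs : HasDerivAt (fun w => (pp 0 w + qq w) / 2) 6 0 := by
      refine (((hasDerivAt_pp 0 0).add (hasDerivAt_qq 0)).div_const 2).congr_deriv ?_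
      rw [al_zero, be_zero, neg_zero, lam_zero, kap_zero]; norm_num
    have hw : (fun w : ℝ => w) =O[𝓝 0] fun w => (pp 0 w + qq w) / 2 := by
      have := (hs.isTheta_sub (by norm_num)).2
      simpa [Function.comp_def, qq_zero, pp_zero, lam_zero] using this
    have hw2 : (fun w : ℝ => w ^ 2) =O[𝓝 0] fun w => ((pp 0 w + qq w) / 2) ^ 2 / 6 := by
      refine (hw.pow 2).trans ((isBigO_const_mul_self 6 _ _).congr_left fun w => ?_)
      ring
    have hsmall : (fun w => height 0 w - ((pp 0 w + qq w) / 2) ^ 2 / 6) =o[𝓝 0]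
        fun w => ((pp 0 w + qq w) / 2) ^ 2 / 6 :=
      (h4.trans_isLittleO (isLittleO_pow_pow (by norm_num : 2 < 4))).trans_isBigO hw2
    have hH : (fun w : ℝ => w ^ 2) =O[𝓝 0] height 0 :=
      hw2.trans (hsmall.right_isBigO_add.congr_right fun w => by ring)
    exact h6.trans ((hH.pow 3).congr_left fun w => by ring)
  · have hp : lam (-l) ≠ 0 := mt lam_neg_eq_zero_iff.1 hl
    have hk := kap_pos (neg_pi_sq_lt_lam (-l))
    have hH := hasDerivAt_height l 0
    have hne : qq 0 * be 0 / al l 0 + pp l 0 * al l 0 / be 0 ≠ 0 := by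
      rw [qq_zero, pp_zero, al_zero, be_zero]; simp [hp, hk.ne']
    have hw : (fun w : ℝ => w) =O[𝓝 0] height l := by
      simpa [Function.comp_def, height_zero] using (hH.isTheta_sub hne).2
    exact (vanishesTo_defect hp).trans (hw.pow 3)

/-- For `l > 0` the curve starts at `w = l`, which the reflection `w ↦ l - w` takes to the
origin. -/
lemma isBigO_defect_max (l : ℝ) :
    defect l =O[𝓝 (max 0 l)] fun w => height l w ^ 3 := by
  rcases max_choice 0 l with h | h <;> rw [h]
  · exact isBigO_defect l
  · have ht : Tendsto (fun w => l - w) (𝓝 l) (𝓝 0) :=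
      (continuous_const.sub continuous_id).tendsto' _ _ (sub_self l)
    refine ((isBigO_defect l).comp_tendsto ht).congr (fun w => ?_) fun w => ?_
    · simp [defect_reflect]
    · simp [height_reflect]

/-- Along the steepest descent curve, the product of the real and imaginary parts has an expansion
in half-integral powers of the phase, with a remainder that is controlled globally. -/
lemma exists_sqrt_expansion (l : ℝ) : ∃ C, 0 ≤ C ∧ ∀ w, max 0 l ≤ w →
    |√(pp l w * qq w) - (√(2 / kap (lam (-l))) * √(height l w)
      + √(2 / kap (lam (-l))) * coeff l / 3 * (height l w * √(height l w)))|
      ≤ C * (height l w ^ 2 * √(height l w)) := by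
  have hk := kap_pos (neg_pi_sq_lt_lam (-l))
  set c₁ := √(2 / kap (lam (-l))) with hc₁
  set c₃ := c₁ * coeff l / 3 with hc₃
  have hc₁0 : 0 < c₁ := Real.sqrt_pos.2 (by positivity)
  have hc₁2 : c₁ ^ 2 = 2 / kap (lam (-l)) := Real.sq_sqrt (by positivity)
  have hM : ∀ w, pp l w * qq w = defect l w + c₁ ^ 2 * height l w
      + 2 * c₁ * c₃ * height l w ^ 2 := by
    intro w
    rw [hc₃, show 2 * c₁ * (c₁ * coeff l / 3) = 2 * c₁ ^ 2 * coeff l / 3 by ring, hc₁2, defect]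
    field_simp
    ring
  obtain ⟨B, hB0, hB⟩ := (isBigO_defect_max l).exists_nonneg
  have hsmall : ∀ᶠ w in 𝓝 (max 0 l), c₁ / 2 ≤ c₁ + c₃ * height l w := by
    have hcont : Tendsto (fun w => c₁ + c₃ * height l w) (𝓝 (max 0 l)) (𝓝 c₁) := by
      simpa [height_max] using
        (((contDiff_height l).continuous.const_mul c₃).const_add c₁).tendsto (max 0 l)
    exact hcont.eventually_const_le (by linarith)
  obtain ⟨δ, hδ, hball⟩ := Metric.eventually_nhds_iff_ball.1 (hB.bound.and hsmall)
  obtain ⟨D, hD0, hD⟩ := exists_pp_le l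
  -- the lower bound of the phase at distance `δ / 2` from the saddle point
  set η := height l (max 0 l + δ / 2) with hη
  have hη0 : 0 < η := height_pos (by linarith)
  have hsη : 0 < √η := Real.sqrt_pos.2 hη0
  set C₁ := 2 * (B + c₃ ^ 2) / c₁
  set C₂ := Real.pi ^ 2 * 2 / (η * √η) + (Real.pi ^ 2 * D + 1) / (η ^ 2 * √η) + c₁ / η ^ 2
    + |c₃| / η
  refine ⟨C₁ + C₂, by positivity, fun w hw => ?_⟩
  set H := height l w with hH
  have hH0 : 0 ≤ H := height_nonneg hw
  have hP := pp_nonneg ((le_max_right 0 l).trans hw)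
  have hQ := qq_nonneg ((le_max_left 0 l).trans hw)
  have hHH : 0 ≤ H ^ 2 * √H := by positivity
  rcases lt_or_ge w (max 0 l + δ / 2) with h | h
  · suffices hs : |√(pp l w * qq w) - (c₁ * √H + c₃ * (H * √H))| ≤ C₁ * (H ^ 2 * √H) by
      refine hs.trans (mul_le_mul_of_nonneg_right ?_ hHH)
      have : 0 ≤ C₂ := by positivity
      linarith
    obtain ⟨hb, hc⟩ := hball w (by
      rw [Metric.mem_ball, Real.dist_eq, abs_lt]; constructor <;> linarith)
    rw [Real.norm_eq_abs, Real.norm_eq_abs, abs_of_nonneg (pow_nonneg hH0 3)] at hb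
    rcases hw.eq_or_lt with h0 | h0
    · have h1 : H = 0 := by rw [hH, ← h0, height_max]
      have h2 : pp l w * qq w = 0 := by rw [← h0, pp_mul_qq_max]
      rw [h1, h2]; simp
    have hH0' : 0 < H := height_pos h0
    set r := √H with hr
    have hr0 : 0 < r := Real.sqrt_pos.2 hH0'
    have hr2 : H = r ^ 2 := (Real.sq_sqrt hH0).symm
    set W := √(pp l w * qq w) with hW
    have hW0 : 0 ≤ W := Real.sqrt_nonneg _
    have hW2 : W ^ 2 = pp l w * qq w := Real.sq_sqrt (mul_nonneg hP hQ)
    set V := c₁ * r + c₃ * (H * r) with hV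
    have hVr : V = r * (c₁ + c₃ * H) := by ring
    have hV1 : c₁ / 2 * r ≤ W + V := by
      rw [hVr]; nlinarith
    -- `W ^ 2 - V ^ 2` is of third order, and `W + V` is at least of order `√H`
    have e : (W - V) * (W + V) = defect l w - c₃ ^ 2 * H ^ 3 := by
      have := hM w
      rw [← hW2, ← hH] at this
      rw [hV]
      linear_combination this - (c₁ ^ 2 + 2 * c₁ * c₃ * H + c₃ ^ 2 * H ^ 2) * (hr2.symm)
    have h1 : |W - V| * (c₁ / 2 * r) ≤ (B + c₃ ^ 2) * H ^ 3 := by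
      calc |W - V| * (c₁ / 2 * r) ≤ |W - V| * |W + V| := by
            gcongr; exact hV1.trans (le_abs_self _)
        _ = |defect l w - c₃ ^ 2 * H ^ 3| := by rw [← abs_mul, e]
        _ ≤ |defect l w| + |c₃ ^ 2 * H ^ 3| := abs_sub _ _
        _ ≤ B * H ^ 3 + c₃ ^ 2 * H ^ 3 := by
            rw [abs_of_nonneg (by positivity : 0 ≤ c₃ ^ 2 * H ^ 3)]; gcongr
        _ = _ := by ring
    have h2 : C₁ * (H ^ 2 * r) * (c₁ / 2 * r) = (B + c₃ ^ 2) * H ^ 3 := by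
      have hC : C₁ * c₁ = 2 * (B + c₃ ^ 2) := div_mul_cancel₀ _ hc₁0.ne'
      linear_combination (H ^ 2 * r ^ 2 / 2) * hC - (B + c₃ ^ 2) * H ^ 2 * hr2
    exact le_of_mul_le_mul_right (h1.trans h2.ge) (by positivity)
  · suffices hs : |√(pp l w * qq w) - (c₁ * √H + c₃ * (H * √H))| ≤ C₂ * (H ^ 2 * √H) by
      refine hs.trans (mul_le_mul_of_nonneg_right ?_ hHH)
      have : 0 ≤ C₁ := by positivity
      linarith
    -- away from the saddle point the last power dominates everything of at most linear growth
    have hηH : η ≤ H := (strictMonoOn_height l).monotoneOn (Set.mem_Ici.2 (by linarith)) hw h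
    have hsH : √η ≤ √H := Real.sqrt_le_sqrt hηH
    have hW : √(pp l w * qq w) ≤ Real.pi ^ 2 * 2 * H + (Real.pi ^ 2 * D + 1) := by
      have h1 : √(pp l w * qq w) ≤ pp l w * qq w + 1 := by
        have h0 := mul_nonneg hP hQ
        refine Real.sqrt_le_iff.2 ⟨by linarith, ?_⟩
        nlinarith
      have h2 : pp l w * qq w ≤ (2 * H + D) * Real.pi ^ 2 :=
        mul_le_mul (hD w hw) (qq_lt w).le hQ (by positivity)
      linarith
    have e1 : H ≤ H ^ 2 * √H / (η * √η) := by
      rw [le_div_iff₀ (by positivity)]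
      nlinarith [mul_le_mul hηH hsH hsη.le hH0]
    have e2 : 1 ≤ H ^ 2 * √H / (η ^ 2 * √η) := by
      rw [le_div_iff₀ (by positivity), one_mul]; gcongr
    have e3 : √H ≤ H ^ 2 * √H / η ^ 2 := by
      rw [le_div_iff₀ (by positivity), mul_comm]; gcongr
    have e4 : H * √H ≤ H ^ 2 * √H / η := by
      rw [le_div_iff₀ (by positivity)]
      nlinarith [mul_le_mul_of_nonneg_left hηH (by positivity : 0 ≤ H * √H)]
    calc |√(pp l w * qq w) - (c₁ * √H + c₃ * (H * √H))|
        ≤ |√(pp l w * qq w)| + (|c₁ * √H| + |c₃ * (H * √H)|) :=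
          (abs_sub _ _).trans (by gcongr; exact abs_add_le _ _)
      _ ≤ (Real.pi ^ 2 * 2 * H + (Real.pi ^ 2 * D + 1) * 1) + (c₁ * √H + |c₃| * (H * √H)) := by
          rw [abs_of_nonneg (Real.sqrt_nonneg _), abs_of_nonneg (by positivity : 0 ≤ c₁ * √H),
            abs_mul c₃, abs_of_nonneg (by positivity : 0 ≤ H * √H), mul_one]
          gcongr
      _ ≤ (Real.pi ^ 2 * 2 * (H ^ 2 * √H / (η * √η))
          + (Real.pi ^ 2 * D + 1) * (H ^ 2 * √H / (η ^ 2 * √η)))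
          + (c₁ * (H ^ 2 * √H / η ^ 2) + |c₃| * (H ^ 2 * √H / η)) := by gcongr
      _ = C₂ * (H ^ 2 * √H) := by simp only [C₂]; ring

/-! ### Watson's lemma along the curve -/

lemma integral_rpow_mul_exp_neg_div {a t : ℝ} (ha : 0 < a) (ht : 0 < t) :
    ∫ u in Set.Ioi (0 : ℝ), Real.exp (-u / t) * u ^ (a - 1) = t ^ a * Real.Gamma a := by
  have h := Real.integral_rpow_mul_exp_neg_mul_Ioi ha (one_div_pos.2 ht)
  rw [one_div_one_div] at h
  rw [← h]
  refine integral_congr_ae (Eventually.of_forall fun u => ?_)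
  simp only
  rw [mul_comm]; congr 2; ring

lemma integrableOn_rpow_mul_exp_neg_div {a t : ℝ} (ha : 0 < a) (ht : 0 < t) :
    IntegrableOn (fun u => Real.exp (-u / t) * u ^ (a - 1)) (Set.Ioi 0) := by
  by_contra h
  have h' := integral_rpow_mul_exp_neg_div ha ht
  rw [integral_undef h] at h'
  exact (mul_pos (Real.rpow_pos_of_pos ht a) (Real.Gamma_pos_of_pos ha)).ne h'

/-- Substituting the phase for the parameter of the curve. -/
lemma tendsto_integral_height {l t : ℝ} (ht : 0 < t) {a : ℝ} (ha : 1 ≤ a) :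
    Tendsto (fun w => ∫ v in (max 0 l)..w, Real.exp (-height l v / t) * height l v ^ (a - 1)
      * deriv (height l) v) atTop (𝓝 (t ^ a * Real.Gamma a)) := by
  have h := intervalIntegral_tendsto_integral_Ioi 0
    (integrableOn_rpow_mul_exp_neg_div (by linarith : 0 < a) ht) (tendsto_height l)
  rw [integral_rpow_mul_exp_neg_div (by linarith) ht] at h
  refine h.congr fun w => ?_
  have hd := contDiff_infty_iff_deriv.1 (contDiff_height l)
  have hc : Continuous fun u : ℝ => Real.exp (-u / t) * u ^ (a - 1) :=
    (by fun_prop : Continuous fun u : ℝ => Real.exp (-u / t)).mul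
      (Real.continuous_rpow_const (by linarith))
  have := intervalIntegral.integral_comp_mul_deriv (a := max 0 l) (b := w)
    (fun x _ => (hd.1 x).hasDerivAt) hd.2.continuous.continuousOn hc
  rw [height_max] at this
  exact this.symm

/-- The Laplace integral along the curve inherits the expansion of its amplitude. -/
lemma exists_laplace_bound (l : ℝ) : ∃ C, 0 ≤ C ∧ ∀ t J : ℝ, 0 < t →
    Tendsto (fun w => ∫ v in (max 0 l)..w, Real.exp (-height l v / t) * √(pp l v * qq v)
      * deriv (height l) v) atTop (𝓝 J) →
    |J - (√(2 / kap (lam (-l))) * (t * √t * (√Real.pi / 2))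
      + √(2 / kap (lam (-l))) * coeff l / 3 * (t ^ 2 * √t * (3 * √Real.pi / 4)))|
      ≤ C * (t ^ 3 * √t) := by
  obtain ⟨C, hC0, hC⟩ := exists_sqrt_expansion l
  have hG2 : Real.Gamma (5 / 2) = 3 * √Real.pi / 4 := by
    rw [show (5 / 2 : ℝ) = (1 / 2 + 1) + 1 by norm_num, Real.Gamma_add_one (by norm_num),
      Real.Gamma_add_one (by norm_num), Real.Gamma_one_half_eq]; ring
  have hG1 : Real.Gamma (3 / 2) = √Real.pi / 2 := by
    rw [show (3 / 2 : ℝ) = 1 / 2 + 1 by norm_num, Real.Gamma_add_one (by norm_num),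
      Real.Gamma_one_half_eq]; ring
  refine ⟨C * Real.Gamma (7 / 2), mul_nonneg hC0 (Real.Gamma_pos_of_pos (by norm_num)).le,
    fun t J ht hJ => ?_⟩
  set c₁ := √(2 / kap (lam (-l)))
  set c₃ := c₁ * coeff l / 3
  have hd := contDiff_infty_iff_deriv.1 (contDiff_height l)
  have hcH := (contDiff_height l).continuous
  have hcd := hd.2.continuous
  have hcp := (contDiff_pp l).continuous
  have hcq := contDiff_qq.continuous
  have r1 : ∀ u : ℝ, 0 ≤ u → u ^ ((3 / 2 : ℝ) - 1) = √u := fun u hu => by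
    rw [Real.sqrt_eq_rpow]; norm_num
  have r2 : ∀ u : ℝ, 0 ≤ u → u ^ ((5 / 2 : ℝ) - 1) = u * √u := fun u hu => by
    rw [show (5 / 2 : ℝ) - 1 = 1 + 1 / 2 by norm_num, Real.rpow_add' hu (by norm_num),
      Real.rpow_one, Real.sqrt_eq_rpow]
  have r3 : ∀ u : ℝ, 0 ≤ u → u ^ ((7 / 2 : ℝ) - 1) = u ^ 2 * √u := fun u hu => by
    rw [show (7 / 2 : ℝ) - 1 = (2 : ℕ) + 1 / 2 by norm_num, Real.rpow_add' hu (by norm_num),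
      Real.rpow_natCast, Real.sqrt_eq_rpow]
  have s1 : t ^ (3 / 2 : ℝ) = t * √t := by
    rw [← r2 t ht.le]; norm_num
  have s2 : t ^ (5 / 2 : ℝ) = t ^ 2 * √t := by
    rw [← r3 t ht.le]; norm_num
  have s3 : t ^ (7 / 2 : ℝ) = t ^ 3 * √t := by
    rw [show (7 / 2 : ℝ) = (3 : ℕ) + 1 / 2 by norm_num, Real.rpow_add ht, Real.rpow_natCast,
      Real.sqrt_eq_rpow]
  have t1 := tendsto_integral_height (l := l) ht (by norm_num : (1 : ℝ) ≤ 3 / 2)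
  have t2 := tendsto_integral_height (l := l) ht (by norm_num : (1 : ℝ) ≤ 5 / 2)
  have t3 := tendsto_integral_height (l := l) ht (by norm_num : (1 : ℝ) ≤ 7 / 2)
  rw [hG1, s1] at t1
  rw [hG2, s2] at t2
  rw [s3] at t3
  have key := (hJ.sub ((t1.const_mul c₁).add (t2.const_mul c₃))).abs
  rw [show C * Real.Gamma (7 / 2) * (t ^ 3 * √t) = C * (t ^ 3 * √t * Real.Gamma (7 / 2)) by ring]
  refine le_of_tendsto_of_tendsto key (t3.const_mul C) ?_
  filter_upwards [eventually_ge_atTop (max 0 l)] with w hw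
  have hcr : ∀ a : ℝ, 1 ≤ a → Continuous fun v => height l v ^ (a - 1) := fun a ha =>
    (Real.continuous_rpow_const (by linarith)).comp hcH
  have i1 := hcr (3 / 2) (by norm_num)
  have i2 := hcr (5 / 2) (by norm_num)
  have i3 := hcr (7 / 2) (by norm_num)
  rw [← intervalIntegral.integral_const_mul, ← intervalIntegral.integral_const_mul,
    ← intervalIntegral.integral_const_mul, ← intervalIntegral.integral_add,
    ← intervalIntegral.integral_sub, ← Real.norm_eq_abs]
  · refine intervalIntegral.norm_integral_le_of_norm_le hw ?_ (Continuous.intervalIntegrable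
      (by fun_prop) _ _)
    refine Eventually.of_forall fun v hv => ?_
    have hv0 : max 0 l ≤ v := hv.1.le
    have hH0 := height_nonneg hv0
    have hdn : 0 ≤ deriv (height l) v := by
      rw [(hasDerivAt_height l v).deriv]
      have := pp_nonneg ((le_max_right 0 l).trans hv0)
      have := qq_nonneg ((le_max_left 0 l).trans hv0)
      have := al_pos l v
      have := be_pos v
      positivity
    rw [r1 _ hH0, r2 _ hH0, r3 _ hH0, Real.norm_eq_abs]
    set E := Real.exp (-height l v / t)
    have hE : 0 ≤ E := (Real.exp_pos _).le
    calc _ = |(√(pp l v * qq v) - (c₁ * √(height l v) + c₃ * (height l v * √(height l v))))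
            * (E * deriv (height l) v)| := by congr 1; ring
      _ ≤ C * (height l v ^ 2 * √(height l v)) * (E * deriv (height l) v) := by
          rw [abs_mul, abs_of_nonneg (mul_nonneg hE hdn)]
          exact mul_le_mul_of_nonneg_right (hC v hv0) (mul_nonneg hE hdn)
      _ = _ := by ring
  all_goals exact Continuous.intervalIntegrable (by fun_prop) _ _

/-! ### The complex phase -/

/-- The complex form of the integrand after the substitution `z = ξ - iπ`. -/
def cIntegrand (ρ t : ℝ) (z : ℂ) : ℂ :=
  -Complex.sinh z * Complex.exp (-(z ^ 2 / 2 - ρ * Complex.cosh z) / t)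

lemma differentiable_cIntegrand (ρ t : ℝ) : Differentiable ℂ (cIntegrand ρ t) := by
  unfold cIntegrand
  fun_prop

lemma sinh_sub_mul_I (x y : ℝ) : Complex.sinh (x - y * Complex.I) =
    ((Real.sinh x * Real.cos y : ℝ) : ℂ) - (Real.cosh x * Real.sin y : ℝ) * Complex.I := by
  rw [Complex.sinh_sub, Complex.cosh_mul_I, Complex.sinh_mul_I]
  push_cast; ring

lemma cosh_sub_mul_I (x y : ℝ) : Complex.cosh (x - y * Complex.I) =
    ((Real.cosh x * Real.cos y : ℝ) : ℂ) - (Real.sinh x * Real.sin y : ℝ) * Complex.I := by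
  rw [Complex.cosh_sub, Complex.cosh_mul_I, Complex.sinh_mul_I]
  push_cast; ring

lemma cIntegrand_sub_mul_I (ρ t x y : ℝ) : cIntegrand ρ t (x - y * Complex.I) =
    (((-(Real.sinh x * Real.cos y) : ℝ) : ℂ) + (Real.cosh x * Real.sin y : ℝ) * Complex.I) *
      Complex.exp (((-((x ^ 2 - y ^ 2) / 2 - ρ * (Real.cosh x * Real.cos y)) / t : ℝ) : ℂ)
        + ((x * y - ρ * (Real.sinh x * Real.sin y)) / t : ℝ) * Complex.I) := by
  rw [cIntegrand, sinh_sub_mul_I, cosh_sub_mul_I]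
  congr 1
  · push_cast; ring
  · congr 1
    push_cast
    have := Complex.I_sq
    linear_combination (-(y : ℂ) ^ 2 / (2 * t)) * this

/-- A chain rule for the imaginary part of a primitive along a real curve. -/
lemma hasDerivAt_im_comp {P f : ℂ → ℂ} (hP : ∀ z, HasDerivAt P (f z) z) {γ : ℝ → ℂ} {γ' : ℂ}
    {s : ℝ} (hγ : HasDerivAt γ γ' s) :
    HasDerivAt (fun s => (P (γ s)).im) (f (γ s) * γ').im s := by
  have h1 : HasDerivAt (fun s => P (γ s)) (f (γ s) * γ') s := by
    have := ((hP (γ s)).hasFDerivAt.restrictScalars ℝ).comp_hasDerivAt s hγ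
    simpa [mul_comm, Function.comp_def] using this
  simpa [Function.comp_def] using Complex.imCLM.hasFDerivAt.comp_hasDerivAt s h1

lemma im_eq_of_im_deriv_eq_zero {P f : ℂ → ℂ} (hP : ∀ z, HasDerivAt P (f z) z) {γ : ℝ → ℂ}
    {γ' : ℂ} (hγ : ∀ s, HasDerivAt γ γ' s) (h0 : ∀ s, (f (γ s) * γ').im = 0) (a b : ℝ) :
    (P (γ a)).im = (P (γ b)).im :=
  is_const_of_deriv_eq_zero (f := fun s => (P (γ s)).im)
    (fun s => (hasDerivAt_im_comp hP (hγ s)).differentiableAt)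
    (fun s => by rw [(hasDerivAt_im_comp hP (hγ s)).deriv, h0]) a b

lemma hasDerivAt_horizontal (y s : ℝ) :
    HasDerivAt (fun s : ℝ => (s : ℂ) - y * Complex.I) 1 s :=
  (hasDerivAt_id s).ofReal_comp.sub_const _

lemma hasDerivAt_vertical (x s : ℝ) :
    HasDerivAt (fun s : ℝ => (x : ℂ) - s * Complex.I) (-Complex.I) s := by
  simpa using ((hasDerivAt_id s).ofReal_comp.mul_const Complex.I).const_sub (x : ℂ)

/-- On the coordinate axes a primitive of `cIntegrand` has constant imaginary part. -/
lemma im_primitive_axes {ρ t : ℝ} {P : ℂ → ℂ} (hP : ∀ z, HasDerivAt P (cIntegrand ρ t z) z)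
    {x y : ℝ} (hxy : x * y = 0) : (P (x - y * Complex.I)).im = (P 0).im := by
  rcases mul_eq_zero.1 hxy with rfl | rfl
  · have h := im_eq_of_im_deriv_eq_zero hP (hasDerivAt_vertical 0) (fun s => by
      rw [cIntegrand_sub_mul_I, Complex.exp_add, ← Complex.ofReal_exp]
      simp only [Real.sinh_zero, zero_mul, mul_zero, sub_self, zero_div,
        Complex.ofReal_zero, Complex.exp_zero, Complex.mul_im, Complex.mul_re, Complex.add_im,
        Complex.add_re, Complex.neg_im, Complex.neg_re, Complex.ofReal_im, Complex.ofReal_re,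
        Complex.I_im, Complex.I_re, Complex.one_im, Complex.one_re]
      ring) y 0
    simpa using h
  · have h := im_eq_of_im_deriv_eq_zero hP (hasDerivAt_horizontal 0) (fun s => by
      rw [cIntegrand_sub_mul_I, Complex.exp_add, ← Complex.ofReal_exp]
      simp only [Real.sin_zero, zero_mul, mul_zero, sub_self, zero_div,
        Complex.ofReal_zero, Complex.exp_zero, Complex.mul_im, Complex.mul_re, Complex.add_im,
        Complex.add_re, Complex.ofReal_im, Complex.ofReal_re, Complex.zero_im, Complex.one_im,
        Complex.one_re]
      ring) x 0
    simpa using h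

/-- On the line `Im z = -π` the imaginary part of `cIntegrand` is the Hartman-Watson integrand. -/
lemma im_cIntegrand_sub_pi_mul_I (ρ t ξ : ℝ) :
    (cIntegrand ρ t (ξ - Real.pi * Complex.I)).im =
      Real.exp (Real.pi ^ 2 / (2 * t)) * integrand (ρ / t) t ξ := by
  rw [cIntegrand_sub_mul_I, Complex.exp_add, ← Complex.ofReal_exp, Complex.exp_ofReal_mul_I,
    Real.cos_pi, Real.sin_pi, integrand]
  have e : Real.exp (-((ξ ^ 2 - Real.pi ^ 2) / 2 - ρ * (Real.cosh ξ * -1)) / t) =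
      Real.exp (Real.pi ^ 2 / (2 * t)) * (Real.exp (-ξ ^ 2 / (2 * t))
        * Real.exp (-(ρ / t) * Real.cosh ξ)) := by
    rw [← Real.exp_add, ← Real.exp_add]; congr 1; ring
  rw [e]
  simp only [mul_zero, sub_zero, mul_neg, mul_one, neg_neg, Complex.ofReal_zero, zero_mul, add_zero]
  simp only [Complex.re_ofReal_mul,
    Complex.add_im, Complex.ofReal_im, Complex.I_im, Complex.mul_im,
    Complex.ofReal_re, Complex.I_re]
  rw [mul_comm ξ Real.pi]
  ring

lemma norm_cIntegrand_le {ρ t x y : ℝ} (hρ : 0 < ρ) (ht : 0 < t) (hy : Real.pi / 2 ≤ y)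
    (hy' : y ≤ Real.pi) : ‖cIntegrand ρ t (x - y * Complex.I)‖ ≤
      Real.cosh x * Real.exp (-((x ^ 2 - Real.pi ^ 2) / 2) / t) := by
  have hc := Real.cos_nonpos_of_pi_div_two_le_of_le hy (by linarith [Real.pi_pos])
  rw [cIntegrand_sub_mul_I, norm_mul, Complex.norm_exp]
  have hch := Real.cosh_pos x
  gcongr
  · rw [Complex.norm_add_mul_I]
    refine Real.sqrt_le_iff.2 ⟨hch.le, ?_⟩
    have h1 := Real.cosh_sq x
    have h2 := Real.sin_sq_add_cos_sq y
    nlinarith [sq_nonneg (Real.cos y), sq_nonneg (Real.sin y)]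
  · simp only [Complex.add_re, Complex.ofReal_re, Complex.re_ofReal_mul, Complex.I_re, mul_zero,
      add_zero]
    gcongr
    nlinarith [mul_nonneg hρ.le (mul_nonneg hch.le (neg_nonneg.2 hc)), Real.pi_pos]

/-! ### Deformation to the steepest descent curve -/

/-- The steepest descent curve from the saddle point to `∞ - iπ`. -/
def curve (l w : ℝ) : ℂ := (√(pp l w) : ℂ) - (√(qq w) : ℂ) * Complex.I

lemma sinh_mul_sin_curve {l w : ℝ} (hw : max 0 l ≤ w) :
    Real.sinh √(pp l w) * Real.sin √(qq w) = Real.exp (-l) * (√(pp l w) * √(qq w)) := by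
  have hp := pp_nonneg ((le_max_right 0 l).trans hw)
  have hq := qq_nonneg ((le_max_left 0 l).trans hw)
  rw [← mul_sinhcSqrt_sq, ← mul_sinhcSqrt_neg_sq, Real.sq_sqrt hp, Real.sq_sqrt hq, pp,
    show -qq w = lam (-w) by simp [qq], sinhcSqrt_lam, sinhcSqrt_lam,
    show -l = (w - l) + -w by ring, Real.exp_add]
  ring

lemma cosh_mul_cos_curve {l w : ℝ} (hw : max 0 l ≤ w) :
    Real.cosh √(pp l w) * Real.cos √(qq w)
      = Real.exp (-l) * ((1 + pp l w * al l w) * (1 - qq w * be w)) := by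
  have hp := pp_nonneg ((le_max_right 0 l).trans hw)
  have hq := qq_nonneg ((le_max_left 0 l).trans hw)
  rw [← coshSqrt_sq, ← coshSqrt_neg_sq, Real.sq_sqrt hp, Real.sq_sqrt hq,
    show -qq w = lam (-w) by simp [qq], coshSqrt_eq_mul (neg_pi_sq_lt_lam _), pp,
    coshSqrt_eq_mul (neg_pi_sq_lt_lam _), sinhcSqrt_lam, sinhcSqrt_lam, ← al, ← be,
    show -l = (w - l) + -w by ring, Real.exp_add, qq]
  ring

/-- On the curve the exponential is real. -/
lemma cIntegrand_curve {l t w : ℝ} (hw : max 0 l ≤ w) :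
    cIntegrand (Real.exp l) t (curve l w) =
      (((-(Real.sinh √(pp l w) * Real.cos √(qq w)) : ℝ) : ℂ)
        + (Real.cosh √(pp l w) * Real.sin √(qq w) : ℝ) * Complex.I) *
      (Real.exp (-saddleValue l / t) * Real.exp (-height l w / t) : ℝ) := by
  have hp := pp_nonneg ((le_max_right 0 l).trans hw)
  have hq := qq_nonneg ((le_max_left 0 l).trans hw)
  have he : ∀ a, Real.exp l * (Real.exp (-l) * a) = a := fun a => by
    rw [← mul_assoc, ← Real.exp_add, add_neg_cancel, Real.exp_zero, one_mul]
  rw [curve, cIntegrand_sub_mul_I, sinh_mul_sin_curve hw, cosh_mul_cos_curve hw, he, he, sub_self,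
    zero_div, Complex.ofReal_zero, zero_mul, add_zero,
    ← Complex.ofReal_exp, ← Real.exp_add, Real.sq_sqrt hp, Real.sq_sqrt hq, height]
  congr 3
  ring

/-- The contribution of the steepest descent curve, integrated by parts. -/
lemma im_primitive_curve {l t : ℝ} {P : ℂ → ℂ}
    (hP : ∀ z, HasDerivAt P (cIntegrand (Real.exp l) t z) z) {w : ℝ} (hw : max 0 l ≤ w) :
    Real.exp (-saddleValue l / t) * Real.exp (-l) / t *
      ∫ v in (max 0 l)..w, Real.exp (-height l v / t) * √(pp l v * qq v) * deriv (height l) v =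
    (P (curve l w)).im - (P 0).im - Real.exp (-saddleValue l / t) * Real.exp (-l)
      * (Real.exp (-height l w / t) * √(pp l w * qq w)) := by
  have hd := contDiff_infty_iff_deriv.1 (contDiff_height l)
  have hcH := (contDiff_height l).continuous
  have hcd := hd.2.continuous
  have hcp := (contDiff_pp l).continuous
  have hcq := contDiff_qq.continuous
  have hcP : Continuous P := continuous_iff_continuousAt.2 fun z => (hP z).continuousAt
  set K := Real.exp (-saddleValue l / t) * Real.exp (-l) with hK
  set Q : ℝ → ℝ := fun w => (P (curve l w)).im - K * (Real.exp (-height l w / t)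
    * √(pp l w * qq w)) with hQ
  have hQc : Continuous Q := by
    have : Continuous (curve l) := by unfold curve; fun_prop
    fun_prop
  have hQd : ∀ v ∈ Set.Ioo (max 0 l) w, HasDerivAt Q (K / t * (Real.exp (-height l v / t)
      * √(pp l v * qq v) * deriv (height l) v)) v := by
    intro v hv
    have hp := pp_pos ((le_max_right 0 l).trans_lt hv.1)
    have hq := qq_pos ((le_max_left 0 l).trans_lt hv.1)
    have hx := (hasDerivAt_pp l v).sqrt hp.ne'
    have hy := (hasDerivAt_qq v).sqrt hq.ne'
    set x' := 2 / al l v / (2 * √(pp l v))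
    set y' := 2 / be v / (2 * √(qq v))
    -- the square roots are differentiable only inside the interval, continuity holds up to its end
    have hZ : HasDerivAt (curve l) (x' - y' * Complex.I) v :=
      hx.ofReal_comp.sub (hy.ofReal_comp.mul_const Complex.I)
    have hW : HasDerivAt (fun w => √(pp l w * qq w)) (x' * √(qq v) + √(pp l v) * y') v := by
      refine (hx.mul hy).congr_of_eventuallyEq ?_
      filter_upwards [Ioi_mem_nhds hv.1] with u hu
      exact Real.sqrt_mul (pp_nonneg ((le_max_right 0 l).trans (le_of_lt hu))) _
    -- both sides of `sinh_mul_sin_curve` have the same derivative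
    have hS := hx.sinh.mul hy.sin
    have hS' := (hx.mul hy).const_mul (Real.exp (-l))
    have heq : (fun w => Real.sinh √(pp l w)) * (fun w => Real.sin √(qq w)) =ᶠ[𝓝 v]
        fun w => Real.exp (-l) * ((fun w => √(pp l w)) * fun w => √(qq w)) w := by
      filter_upwards [Ioi_mem_nhds hv.1] with u hu
      exact sinh_mul_sin_curve (le_of_lt hu)
    have hSS := hS.unique (hS'.congr_of_eventuallyEq heq)
    have hE := ((hd.1 v).hasDerivAt.neg.div_const t).exp
    have h := (hasDerivAt_im_comp hP hZ).sub ((hE.mul hW).const_mul K)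
    refine h.congr_deriv ?_
    rw [cIntegrand_curve hv.1.le]
    have him : ((((-(Real.sinh √(pp l v) * Real.cos √(qq v)) : ℝ) : ℂ)
        + (Real.cosh √(pp l v) * Real.sin √(qq v) : ℝ) * Complex.I) *
        (Real.exp (-saddleValue l / t) * Real.exp (-height l v / t) : ℝ)
        * (x' - y' * Complex.I)).im = Real.exp (-saddleValue l / t) * Real.exp (-height l v / t)
        * (Real.cosh √(pp l v) * x' * Real.sin √(qq v)
          + Real.sinh √(pp l v) * (Real.cos √(qq v) * y')) := by
      simp only [Complex.mul_im, Complex.mul_re, Complex.add_im, Complex.add_re, Complex.sub_im,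
        Complex.sub_re, Complex.ofReal_im, Complex.ofReal_re, Complex.I_im, Complex.I_re]
      ring
    rw [him, hSS, hK]
    simp only [Pi.neg_apply]
    ring
  have hint := intervalIntegral.integral_eq_sub_of_hasDerivAt_of_le hw hQc.continuousOn hQd
    (Continuous.intervalIntegrable (by fun_prop) _ _)
  have h0 : Q (max 0 l) = (P 0).im := by
    have h1 : √(pp l (max 0 l)) * √(qq (max 0 l)) = 0 := by
      rw [← Real.sqrt_mul (pp_nonneg (le_max_right 0 l)), pp_mul_qq_max, Real.sqrt_zero]
    simp only [hQ, curve, im_primitive_axes hP h1, pp_mul_qq_max, Real.sqrt_zero, mul_zero,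
      sub_zero]
  rw [intervalIntegral.integral_const_mul, h0] at hint
  rw [hint]
  ring

/-- The line `Im z = -π` carries the Hartman-Watson integral. -/
lemma im_primitive_line {ρ t : ℝ} {P : ℂ → ℂ} (hP : ∀ z, HasDerivAt P (cIntegrand ρ t z) z)
    (x : ℝ) : (P (x - Real.pi * Complex.I)).im - (P 0).im =
      Real.exp (Real.pi ^ 2 / (2 * t)) * ∫ ξ in (0 : ℝ)..x, integrand (ρ / t) t ξ := by
  have hc : Continuous (integrand (ρ / t) t) := by unfold integrand; fun_prop
  have hd : ∀ ξ ∈ Set.uIcc 0 x, HasDerivAt (fun s : ℝ => (P (s - Real.pi * Complex.I)).im)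
      (Real.exp (Real.pi ^ 2 / (2 * t)) * integrand (ρ / t) t ξ) ξ := fun ξ _ => by
    refine (hasDerivAt_im_comp hP (hasDerivAt_horizontal Real.pi ξ)).congr_deriv ?_
    rw [mul_one, im_cIntegrand_sub_pi_mul_I]
  have h := intervalIntegral.integral_eq_sub_of_hasDerivAt hd
    (Continuous.intervalIntegrable (by fun_prop) _ _)
  have h0 := im_primitive_axes hP (zero_mul Real.pi)
  rw [← h0, ← intervalIntegral.integral_const_mul, h]

lemma norm_primitive_sub_le {ρ t : ℝ} (hρ : 0 < ρ) (ht : 0 < t) {P : ℂ → ℂ}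
    (hP : ∀ z, HasDerivAt P (cIntegrand ρ t z) z) (x : ℝ) {y : ℝ} (hy : Real.pi / 2 ≤ y)
    (hy' : y ≤ Real.pi) : ‖P (x - Real.pi * Complex.I) - P (x - y * Complex.I)‖ ≤
      Real.cosh x * Real.exp (-((x ^ 2 - Real.pi ^ 2) / 2) / t) * Real.pi := by
  have h := (convex_Icc (Real.pi / 2) Real.pi).norm_image_sub_le_of_norm_hasDerivWithin_le
    (f := fun s : ℝ => P (x - s * Complex.I))
    (f' := fun s => cIntegrand ρ t (x - s * Complex.I) * -Complex.I)
    (C := Real.cosh x * Real.exp (-((x ^ 2 - Real.pi ^ 2) / 2) / t)) (x := y) (y := Real.pi)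
    (fun s _ => by
      have := ((hP _).hasFDerivAt.restrictScalars ℝ).comp_hasDerivAt s (hasDerivAt_vertical x s)
      exact HasDerivAt.hasDerivWithinAt (by simpa [mul_comm, Function.comp_def] using this))
    (fun s hs => by
      rw [norm_mul, norm_neg, Complex.norm_I, mul_one]
      exact norm_cIntegrand_le hρ ht hs.1 hs.2)
    ⟨hy, hy'⟩ ⟨by linarith [Real.pi_pos], le_rfl⟩
  refine h.trans (mul_le_mul_of_nonneg_left ?_ (mul_pos (Real.cosh_pos x) (Real.exp_pos _)).le)
  rw [Real.norm_eq_abs, abs_of_nonneg (by linarith)]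
  linarith [Real.pi_pos]

lemma integrableOn_integrand {r t : ℝ} (hr : 0 < r) (ht : 0 < t) :
    IntegrableOn (integrand r t) (Set.Ioi 0) := by
  have hd : ∀ x ∈ Set.Ici (0 : ℝ), HasDerivAt (fun x => -Real.exp (-r * Real.cosh x) / r)
      (Real.exp (-r * Real.cosh x) * Real.sinh x) x := fun x _ => by
    refine (((Real.hasDerivAt_cosh x).const_mul (-r)).exp.neg.div_const r).congr_deriv ?_
    field_simp
  have hlim : Tendsto (fun x => -Real.exp (-r * Real.cosh x) / r) atTop (𝓝 (-0 / r)) := by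
    refine ((Real.tendsto_exp_atBot.comp ?_).neg).div_const r
    refine Tendsto.const_mul_atTop_of_neg (by linarith) ?_
    refine tendsto_atTop_mono (f := fun x : ℝ => x) (fun x => ?_) tendsto_id
    have := Real.sinh_lt_cosh x
    rcases le_total 0 x with h | h
    · exact (Real.self_le_sinh_iff.2 h).trans this.le
    · exact h.trans (Real.cosh_pos x).le
  have hg := integrableOn_Ioi_deriv_of_nonneg' hd (fun x hx =>
    mul_nonneg (Real.exp_pos _).le (Real.sinh_nonneg_iff.2 (le_of_lt hx))) hlim
  have hc : Continuous (integrand r t) := by unfold integrand; fun_prop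
  refine Integrable.mono' hg hc.aestronglyMeasurable ?_
  filter_upwards [ae_restrict_mem measurableSet_Ioi] with x hx
  have hs : 0 ≤ Real.sinh x := Real.sinh_nonneg_iff.2 (le_of_lt hx)
  have h1 : Real.exp (-x ^ 2 / (2 * t)) ≤ 1 := Real.exp_le_one_iff.2
    (div_nonpos_of_nonpos_of_nonneg (by nlinarith [sq_nonneg x]) (by positivity))
  rw [integrand, norm_mul, norm_mul, norm_mul, Real.norm_eq_abs, Real.norm_eq_abs, Real.norm_eq_abs,
    Real.norm_eq_abs, Real.abs_exp, Real.abs_exp, abs_of_nonneg hs]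
  calc _ ≤ 1 * Real.exp (-r * Real.cosh x) * Real.sinh x * 1 := by
        gcongr
        exact Real.abs_sin_le_one _
    _ = _ := by ring

lemma tendsto_cosh_mul_exp {t : ℝ} (ht : 0 < t) : Tendsto (fun x => Real.cosh x *
    Real.exp (-((x ^ 2 - Real.pi ^ 2) / 2) / t) * Real.pi) atTop (𝓝 0) := by
  have h1 : Tendsto (fun x : ℝ => x * (-1 / (2 * t) * x + 1) + Real.pi ^ 2 / (2 * t))
      atTop atBot := by
    refine tendsto_atBot_add_const_right _ _ (tendsto_id.atTop_mul_atBot₀ ?_)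
    exact tendsto_atBot_add_const_right _ _ (tendsto_id.const_mul_atTop_of_neg
      (div_neg_of_neg_of_pos (by norm_num) (by positivity)))
  have h2 := (Real.tendsto_exp_atBot.comp h1).mul_const Real.pi
  rw [zero_mul] at h2
  refine squeeze_zero' (Eventually.of_forall fun x => ?_) ?_ h2
  · have := Real.cosh_pos x
    have := Real.pi_pos
    positivity
  · filter_upwards [eventually_ge_atTop 0] with x hx
    have hc : Real.cosh x ≤ Real.exp x := by
      rw [← Real.cosh_add_sinh]
      linarith [Real.sinh_nonneg_iff.2 hx]
    calc _ ≤ Real.exp x * Real.exp (-((x ^ 2 - Real.pi ^ 2) / 2) / t) * Real.pi := by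
          gcongr
      _ = _ := by
          rw [← Real.exp_add, Function.comp_apply]
          congr 2
          field_simp
          ring

lemma tendsto_exp_mul_sqrt (l : ℝ) {t : ℝ} (ht : 0 < t) :
    Tendsto (fun w => Real.exp (-height l w / t) * √(pp l w * qq w)) atTop (𝓝 0) := by
  obtain ⟨C, hC0, hC⟩ := exists_pp_le l
  have hu : Tendsto (fun w => height l w / t) atTop atTop := (tendsto_height l).atTop_div_const ht
  have h1 := (Real.tendsto_pow_mul_exp_neg_atTop_nhds_zero 1).comp hu
  have h0 := (Real.tendsto_pow_mul_exp_neg_atTop_nhds_zero 0).comp hu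
  have h := (h1.const_mul (2 * t * Real.pi ^ 2)).add (h0.const_mul (C * Real.pi ^ 2 + 1))
  rw [mul_zero, mul_zero, add_zero] at h
  refine squeeze_zero' (Eventually.of_forall fun w => by positivity) ?_ h
  filter_upwards [eventually_ge_atTop (max 0 l)] with w hw
  have hP := pp_nonneg ((le_max_right 0 l).trans hw)
  have hQ := qq_nonneg ((le_max_left 0 l).trans hw)
  have hM := mul_nonneg hP hQ
  have hH := height_nonneg hw
  have hs : √(pp l w * qq w) ≤ pp l w * qq w + 1 :=
    Real.sqrt_le_iff.2 ⟨by linarith, by nlinarith⟩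
  have hb : pp l w * qq w ≤ (2 * height l w + C) * Real.pi ^ 2 :=
    mul_le_mul (hC w hw) (qq_lt w).le hQ (by positivity)
  calc _ ≤ Real.exp (-height l w / t) * ((2 * height l w + C) * Real.pi ^ 2 + 1) := by
        gcongr; linarith
    _ = _ := by
        simp only [Function.comp_apply, pow_one, pow_zero, one_mul, ← neg_div]
        field_simp
        ring

/-- The Hartman-Watson integral as a Laplace integral along the steepest descent curve. -/
lemma tendsto_integral_curve (l : ℝ) {t : ℝ} (ht : 0 < t) :
    Tendsto (fun w => ∫ v in (max 0 l)..w, Real.exp (-height l v / t) * √(pp l v * qq v)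
      * deriv (height l) v) atTop (𝓝 (t * Real.exp l * Real.exp (saddleValue l / t)
        * (Real.exp (Real.pi ^ 2 / (2 * t)) *
          ∫ ξ in Set.Ioi (0 : ℝ), integrand (Real.exp l / t) t ξ))) := by
  obtain ⟨P, hP'⟩ := (differentiable_cIntegrand (Real.exp l) t).isExactOn_univ
  have hP : ∀ z, HasDerivAt P (cIntegrand (Real.exp l) t z) z := fun z => hP' z (Set.mem_univ z)
  have hx : Tendsto (fun w => √(pp l w)) atTop atTop :=
    Real.tendsto_sqrt_atTop.comp (tendsto_pp l)
  have hline := (intervalIntegral_tendsto_integral_Ioi 0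
    (integrableOn_integrand (div_pos (Real.exp_pos l) ht) ht) hx).const_mul
      (Real.exp (Real.pi ^ 2 / (2 * t)))
  have hend : Tendsto (fun w => (P (curve l w)).im - (P (√(pp l w) - Real.pi * Complex.I)).im)
      atTop (𝓝 0) := by
    refine squeeze_zero_norm' ?_ ((tendsto_cosh_mul_exp ht).comp hx)
    have hq : -Real.pi ^ 2 < -(Real.pi / 2) ^ 2 := by nlinarith [Real.pi_pos]
    filter_upwards [eventually_ge_atTop (-Real.log (sinhcSqrt (-(Real.pi / 2) ^ 2))),
      eventually_ge_atTop 0] with w hw hw0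
    have h1 : Real.pi / 2 ≤ √(qq w) := by
      refine Real.le_sqrt_of_sq_le ?_
      have h2 : lam (-w) ≤ lam (Real.log (sinhcSqrt (-(Real.pi / 2) ^ 2))) :=
        strictMono_lam.monotone (by linarith)
      rw [lam_log_sinhcSqrt hq] at h2
      rw [qq]; linarith
    have h3 : √(qq w) ≤ Real.pi := Real.sqrt_le_iff.2 ⟨Real.pi_pos.le, (qq_lt w).le⟩
    refine le_trans ?_ (norm_primitive_sub_le (Real.exp_pos l) ht hP _ h1 h3)
    rw [norm_sub_rev, Real.norm_eq_abs, ← Complex.sub_im]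
    exact Complex.abs_im_le_norm _
  have hbd := (tendsto_exp_mul_sqrt l ht).const_mul
    (Real.exp (-saddleValue l / t) * Real.exp (-l))
  have h := ((hend.add hline).sub hbd).const_mul (t * Real.exp l * Real.exp (saddleValue l / t))
  rw [zero_add, mul_zero, sub_zero] at h
  refine h.congr' ?_
  filter_upwards [eventually_ge_atTop (max 0 l)] with w hw
  rw [← im_primitive_line hP]
  have hc := im_primitive_curve hP hw
  rw [show (P (curve l w)).im - (P (√(pp l w) - Real.pi * Complex.I)).im
    + ((P (√(pp l w) - Real.pi * Complex.I)).im - (P 0).im) - Real.exp (-saddleValue l / t)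
      * Real.exp (-l) * (Real.exp (-height l w / t) * √(pp l w * qq w)) = _ from
    (by ring : _ = (P (curve l w)).im - (P 0).im - Real.exp (-saddleValue l / t) * Real.exp (-l)
      * (Real.exp (-height l w / t) * √(pp l w * qq w))).trans hc.symm]
  have e1 : Real.exp l * Real.exp (-l) = 1 := by rw [← Real.exp_add]; simp
  have e2 : Real.exp (saddleValue l / t) * Real.exp (-saddleValue l / t) = 1 := by
    rw [← Real.exp_add, neg_div]; simp
  have e3 : t * (1 / t) = 1 := by field_simp
  generalize (∫ v in (max 0 l)..w, Real.exp (-height l v / t) * √(pp l v * qq v)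
      * deriv (height l) v) = J
  calc _ = (Real.exp l * Real.exp (-l)) * (Real.exp (saddleValue l / t)
        * Real.exp (-saddleValue l / t)) * (t * (1 / t)) * J := by ring
    _ = J := by rw [e1, e2, e3]; ring

/-! ### The saddle points and the coefficient functions -/

lemma sinhcSqrt_lam_neg_log {ρ : ℝ} (hρ : 0 < ρ) : ρ * sinhcSqrt (lam (-Real.log ρ)) = 1 := by
  rw [sinhcSqrt_lam, Real.exp_neg, Real.exp_log hρ, mul_inv_cancel₀ hρ.ne']

lemma lam_neg_log_eq {ρ p : ℝ} (hρ : 0 < ρ) (hp : -Real.pi ^ 2 < p) (h : ρ * sinhcSqrt p = 1) :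
    lam (-Real.log ρ) = p := by
  refine lam_eq_of_sinhcSqrt_eq hp ?_
  rw [Real.exp_neg, Real.exp_log hρ, eq_inv_of_mul_eq_one_right h]

lemma lam_neg_log_pos {ρ : ℝ} (hρ : 0 < ρ) (h1 : ρ < 1) : 0 < lam (-Real.log ρ) := by
  rw [← lam_zero]; exact strictMono_lam (by linarith [Real.log_neg hρ h1])

lemma lam_neg_log_neg {ρ : ℝ} (h1 : 1 < ρ) : lam (-Real.log ρ) < 0 := by
  rw [← lam_zero]; exact strictMono_lam (by linarith [Real.log_pos h1])

lemma isX1_iff {ρ x : ℝ} (hρ : 0 < ρ) (h1 : ρ < 1) : IsX1 ρ x ↔ x = √(lam (-Real.log ρ)) := by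
  have hl := lam_neg_log_pos hρ h1
  have key : ∀ x : ℝ, 0 < x → Real.sinh x / x = sinhcSqrt (x ^ 2) := fun x hx => by
    rw [← mul_sinhcSqrt_sq, mul_div_cancel_left₀ _ hx.ne']
  constructor
  · rintro ⟨hx, h⟩
    rw [key x hx] at h
    rw [lam_neg_log_eq hρ (by nlinarith [Real.pi_pos]) h, Real.sqrt_sq hx.le]
  · rintro rfl
    refine ⟨Real.sqrt_pos.2 hl, ?_⟩
    rw [key _ (Real.sqrt_pos.2 hl), Real.sq_sqrt hl.le, sinhcSqrt_lam_neg_log hρ]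

lemma isY1_iff {ρ y : ℝ} (h1 : 1 < ρ) : IsY1 ρ y ↔ y = Real.pi - √(-lam (-Real.log ρ)) := by
  have hρ : 0 < ρ := by linarith
  have hl := lam_neg_log_neg h1
  have hlt : √(-lam (-Real.log ρ)) < Real.pi :=
    (Real.sqrt_lt' Real.pi_pos).2 (by linarith [neg_pi_sq_lt_lam (-Real.log ρ)])
  have h0 : 0 < √(-lam (-Real.log ρ)) := Real.sqrt_pos.2 (by linarith)
  constructor
  · rintro ⟨hy, hy', h⟩
    have hs := mul_sinhcSqrt_neg_sq (Real.pi - y)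
    rw [Real.sin_pi_sub] at hs
    have hz : 0 < Real.pi - y := by linarith
    have h2 : ρ * sinhcSqrt (-(Real.pi - y) ^ 2) = 1 := by
      refine mul_left_cancel₀ hz.ne' ?_
      linear_combination ρ * hs + h
    rw [lam_neg_log_eq hρ (by nlinarith) h2, neg_neg, Real.sqrt_sq hz.le]
    ring
  · rintro rfl
    refine ⟨by linarith, by linarith, ?_⟩
    rw [Real.sin_pi_sub, ← mul_sinhcSqrt_neg_sq, Real.sq_sqrt (by linarith), neg_neg]
    linear_combination √(-lam (-Real.log ρ)) * sinhcSqrt_lam_neg_log hρ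

lemma x1_eq {ρ : ℝ} (hρ : 0 < ρ) (h1 : ρ < 1) : x1 ρ = √(lam (-Real.log ρ)) :=
  (isX1_iff hρ h1).1 (Classical.epsilon_spec (p := IsX1 ρ) ⟨_, (isX1_iff hρ h1).2 rfl⟩)

lemma y1_eq {ρ : ℝ} (h1 : 1 < ρ) : y1 ρ = Real.pi - √(-lam (-Real.log ρ)) :=
  (isY1_iff h1).1 (Classical.epsilon_spec (p := IsY1 ρ) ⟨_, (isY1_iff h1).2 rfl⟩)

lemma mul_coshSqrt_lam {ρ : ℝ} (hρ : 0 < ρ) : ρ * coshSqrt (lam (-Real.log ρ)) =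
    1 + lam (-Real.log ρ) * kap (lam (-Real.log ρ)) := by
  rw [coshSqrt_eq_mul (neg_pi_sq_lt_lam _), ← mul_assoc, sinhcSqrt_lam_neg_log hρ, one_mul]

lemma mul_cosh_x1 {ρ : ℝ} (hρ : 0 < ρ) (h1 : ρ < 1) : ρ * Real.cosh (x1 ρ) =
    1 + lam (-Real.log ρ) * kap (lam (-Real.log ρ)) := by
  rw [x1_eq hρ h1, ← coshSqrt_sq, Real.sq_sqrt (lam_neg_log_pos hρ h1).le, mul_coshSqrt_lam hρ]

lemma mul_sinh_x1 {ρ : ℝ} (hρ : 0 < ρ) (h1 : ρ < 1) : ρ * Real.sinh (x1 ρ) = x1 ρ := by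
  have h := (isX1_iff hρ h1).2 (x1_eq hρ h1)
  have := h.2
  have h0 := h.1.ne'
  field_simp at this
  exact this

lemma mul_cos_y1 {ρ : ℝ} (h1 : 1 < ρ) : ρ * Real.cos (y1 ρ) =
    -(1 + lam (-Real.log ρ) * kap (lam (-Real.log ρ))) := by
  have hl := lam_neg_log_neg h1
  rw [y1_eq h1, Real.cos_pi_sub, ← coshSqrt_neg_sq, Real.sq_sqrt (by linarith), neg_neg,
    ← mul_coshSqrt_lam (by linarith), mul_neg]

lemma mul_sin_y1 {ρ : ℝ} (h1 : 1 < ρ) : ρ * Real.sin (y1 ρ) = Real.pi - y1 ρ := by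
  have h := ((isY1_iff h1).2 (y1_eq h1)).2.2
  linarith

lemma F_sub_eq {ρ : ℝ} (hρ : 0 < ρ) : F ρ - Real.pi ^ 2 / 2 = saddleValue (Real.log ρ) := by
  rw [F, saddleValue]
  split_ifs with h1 h2
  · rw [mul_cosh_x1 hρ h1, x1_eq hρ h1, Real.sq_sqrt (lam_neg_log_pos hρ h1).le]
    ring
  · subst h2
    rw [Real.log_one, neg_zero, lam_zero]; ring
  · have h3 : 1 < ρ := lt_of_le_of_ne (not_lt.1 h1) (Ne.symm h2)
    rw [mul_cos_y1 h3, y1_eq h3]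
    have := Real.sq_sqrt (neg_nonneg.2 (lam_neg_log_neg h3).le)
    linear_combination -this / 2

lemma G_eq {ρ : ℝ} (hρ : 0 < ρ) : G ρ = 1 / √(kap (lam (-Real.log ρ))) := by
  have hk := kap_pos (neg_pi_sq_lt_lam (-Real.log ρ))
  rw [G]
  split_ifs with h1 h2
  · have hl := lam_neg_log_pos hρ h1
    rw [mul_sinh_x1 hρ h1, mul_cosh_x1 hρ h1, x1_eq hρ h1, add_sub_cancel_left,
      Real.sqrt_mul hl.le]
    have := (Real.sqrt_pos.2 hl).ne'
    field_simp
  · subst h2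
    rw [Real.log_one, neg_zero, lam_zero, kap_zero, one_div 3, Real.sqrt_inv, one_div, inv_inv]
  · have h3 : 1 < ρ := lt_of_le_of_ne (not_lt.1 h1) (Ne.symm h2)
    have hl := neg_pos.2 (lam_neg_log_neg h3)
    rw [mul_sin_y1 h3, mul_cos_y1 h3, y1_eq h3, sub_sub_cancel,
      show 1 + -(1 + lam (-Real.log ρ) * kap (lam (-Real.log ρ)))
        = -lam (-Real.log ρ) * kap (lam (-Real.log ρ)) by ring, Real.sqrt_mul hl.le]
    have := (Real.sqrt_pos.2 hl).ne'
    field_simp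

lemma g2_eq {ρ : ℝ} (hρ : 0 < ρ) : g2 ρ = coeff (Real.log ρ) := by
  have hsq : (1 + lam (-Real.log ρ) * kap (lam (-Real.log ρ))) ^ 2 - lam (-Real.log ρ)
      = ρ ^ 2 := by
    rw [← mul_coshSqrt_lam hρ]
    linear_combination ρ ^ 2 * coshSqrt_sq_sub (lam (-Real.log ρ))
      + lam (-Real.log ρ) * (ρ * sinhcSqrt (lam (-Real.log ρ)) + 1) * sinhcSqrt_lam_neg_log hρ
  rw [g2, coeff]
  split_ifs with h1 h2 h3 h4 h5
  · exact absurd h2 (lam_neg_log_pos hρ h1).ne'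
  · have hc := mul_cosh_x1 hρ h1
    rw [mul_assoc 9, mul_assoc 2, ← mul_pow, hc, ← hsq]
    congr 1 <;> ring
  · rfl
  · subst h3
    exact absurd (by rw [Real.log_one, neg_zero, lam_zero]) h4
  · have h6 : 1 < ρ := lt_of_le_of_ne (not_lt.1 h1) (Ne.symm h3)
    exact absurd h5 (lam_neg_log_neg h6).ne
  · have h6 : 1 < ρ := lt_of_le_of_ne (not_lt.1 h1) (Ne.symm h3)
    have hc := mul_cos_y1 h6
    rw [mul_assoc 9, mul_assoc 2, ← mul_pow, hc, ← hsq, ← neg_div_neg_eq]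
    congr 1 <;> ring

lemma existsUnique_x1 {ρ : ℝ} (hρ : 0 < ρ) (h1 : ρ < 1) :
    (∃! x : ℝ, IsX1 ρ x) ∧ IsX1 ρ (x1 ρ) ∧ 0 < ρ * Real.cosh (x1 ρ) - 1 := by
  refine ⟨⟨_, (isX1_iff hρ h1).2 rfl, fun y hy => (isX1_iff hρ h1).1 hy⟩,
    (isX1_iff hρ h1).2 (x1_eq hρ h1), ?_⟩
  rw [mul_cosh_x1 hρ h1, add_sub_cancel_left]
  exact mul_pos (lam_neg_log_pos hρ h1) (kap_pos (neg_pi_sq_lt_lam _))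

lemma existsUnique_y1 {ρ : ℝ} (h1 : 1 < ρ) :
    (∃! y : ℝ, IsY1 ρ y) ∧ IsY1 ρ (y1 ρ) ∧ 0 < 1 + ρ * Real.cos (y1 ρ) := by
  refine ⟨⟨_, (isY1_iff h1).2 rfl, fun y hy => (isY1_iff h1).1 hy⟩,
    (isY1_iff h1).2 (y1_eq h1), ?_⟩
  rw [mul_cos_y1 h1]
  have := mul_neg_of_neg_of_pos (lam_neg_log_neg h1) (kap_pos (neg_pi_sq_lt_lam (-Real.log ρ)))
  linarith

/-! ### The expansion -/

/-- The relative remainder of the two-term expansion. -/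
def remainder (ρ t : ℝ) : ℝ :=
  theta (ρ / t) t / Real.exp (-(1 / t) * (F ρ - Real.pi ^ 2 / 2))
    - (1 / (2 * Real.pi * t) * G ρ + G1 ρ)

lemma exists_abs_remainder_le {ρ : ℝ} (hρ : 0 < ρ) :
    ∃ C, ∀ t, 0 < t → |remainder ρ t| ≤ C * t := by
  set l := Real.log ρ with hl
  have hel : Real.exp l = ρ := Real.exp_log hρ
  obtain ⟨C, hC0, hC⟩ := exists_laplace_bound l
  have hk := kap_pos (neg_pi_sq_lt_lam (-l))
  refine ⟨C / √(2 * Real.pi ^ 3), fun t ht => ?_⟩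
  have hT := tendsto_integral_curve l ht
  rw [hel] at hT
  set I := ∫ ξ in Set.Ioi (0 : ℝ), integrand (ρ / t) t ξ with hI
  set J := t * ρ * Real.exp (saddleValue l / t) * (Real.exp (Real.pi ^ 2 / (2 * t)) * I) with hJ
  have hb := hC t J ht hT
  have hst : 0 < √t := Real.sqrt_pos.2 ht
  have hst2 : √t ^ 2 = t := Real.sq_sqrt ht.le
  have hπ := Real.pi_pos
  have hsπ : 0 < √Real.pi := Real.sqrt_pos.2 hπ
  have hS : √(2 * Real.pi ^ 3) = √2 * (Real.pi * √Real.pi) := by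
    rw [Real.sqrt_mul two_pos.le, show Real.pi ^ 3 = Real.pi ^ 2 * Real.pi by ring,
      Real.sqrt_mul (by positivity), Real.sqrt_sq hπ.le]
  have h2 : 0 < √(2 : ℝ) := Real.sqrt_pos.2 two_pos
  have h22 : √(2 : ℝ) ^ 2 = 2 := Real.sq_sqrt two_pos.le
  have hden : √(2 * Real.pi ^ 3 * t) = √2 * (Real.pi * √Real.pi) * √t := by
    rw [Real.sqrt_mul (by positivity), hS]
  set D := t ^ 2 * (√2 * (Real.pi * √Real.pi) * √t) with hD
  have hD0 : 0 < D := by positivity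
  have hθ : theta (ρ / t) t / Real.exp (-(1 / t) * (F ρ - Real.pi ^ 2 / 2)) = J / D := by
    rw [F_sub_eq hρ, theta, ← hI, hden, hJ, hD, ← hl,
      show -(1 / t) * saddleValue l = -(saddleValue l / t) by ring, Real.exp_neg]
    field_simp
  have hc : √(2 / kap (lam (-l))) = √2 * G ρ := by
    rw [G_eq hρ, ← hl, Real.sqrt_div two_pos.le]; ring
  have hmain : 1 / (2 * Real.pi * t) * G ρ + G1 ρ =
      (√(2 / kap (lam (-l))) * (t * √t * (√Real.pi / 2))
      + √(2 / kap (lam (-l))) * coeff l / 3 * (t ^ 2 * √t * (3 * √Real.pi / 4))) / D := by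
    rw [G1, g2_eq hρ, ← hl, hc, hD]
    field_simp
  rw [remainder, hθ, hmain, ← sub_div, abs_div, abs_of_pos hD0, div_le_iff₀ hD0]
  refine hb.trans_eq ?_
  rw [hS, hD]
  field_simp

end

end HartmanWatson

theorem proposition1 :
    -- the integral defining `θ(r,t)` converges absolutely
    (∀ r t : ℝ, 0 < r → 0 < t →
      IntegrableOn (HartmanWatson.integrand r t) (Set.Ioi (0 : ℝ))) ∧
    -- `x₁` and `y₁` are well defined, and the denominators in `G`, `g̃₂` are positive
    (∀ ρ : ℝ, 0 < ρ → ρ < 1 →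
      (∃! x : ℝ, HartmanWatson.IsX1 ρ x) ∧ HartmanWatson.IsX1 ρ (HartmanWatson.x1 ρ) ∧
        0 < ρ * Real.cosh (HartmanWatson.x1 ρ) - 1) ∧
    (∀ ρ : ℝ, 1 < ρ →
      (∃! y : ℝ, HartmanWatson.IsY1 ρ y) ∧ HartmanWatson.IsY1 ρ (HartmanWatson.y1 ρ) ∧
        0 < 1 + ρ * Real.cos (HartmanWatson.y1 ρ)) ∧
    -- the expansion as `t → 0` at fixed `ρ > 0`
    (∀ ρ : ℝ, 0 < ρ →
      ∃ R : ℝ → ℝ, R =O[𝓝[>] (0 : ℝ)] (fun t : ℝ => t) ∧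
        ∀ t : ℝ, 0 < t →
          HartmanWatson.theta (ρ / t) t =
            Real.exp (-(1 / t) * (HartmanWatson.F ρ - Real.pi ^ 2 / 2)) *
              (1 / (2 * Real.pi * t) * HartmanWatson.G ρ + HartmanWatson.G1 ρ + R t)) := by
  refine ⟨fun r t => HartmanWatson.integrableOn_integrand,
    fun ρ => HartmanWatson.existsUnique_x1, fun ρ => HartmanWatson.existsUnique_y1,
    fun ρ hρ => ⟨HartmanWatson.remainder ρ, ?_, fun t ht => ?_⟩⟩
  · obtain ⟨C, hC⟩ := HartmanWatson.exists_abs_remainder_le hρ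
    refine IsBigO.of_bound C ?_
    filter_upwards [self_mem_nhdsWithin] with t ht
    rw [Real.norm_eq_abs, Real.norm_eq_abs, abs_of_pos (Set.mem_Ioi.1 ht)]
    exact hC t ht
  · rw [HartmanWatson.remainder, add_sub_cancel, mul_div_cancel₀ _ (Real.exp_pos _).ne']
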